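/- Let $\mathbb X$ be a compact, connected, smooth Riemannian manifold (without boundary) with geodesic distance $\rho$, let $\mu$ be a Borel probability measure on $\mathbb X$, and write $B(x,r)=\{y:\rho(x,y)\le r\}$. Fix constants $\alpha,\kappa_1,\kappa_2,\kappa_3,\kappa_4>0$ and $A^*\ge 2$, and assume $\mu(B(x,r))\le\kappa_1r^\alpha$ for all $x\in\mathbb X$, $r>0$. Let $\{\phi_k\}_{k\ge 0}$ be a system of continuous functions $\mathbb X\to\mathbb C$, orthonormal in $L^2(\mu)$, with $\phi_0\equiv 1$, and let $\{\ell_k\}_{k\ge0}$ be a nondecreasing sequence of real numbers with $\ell_0=1$ and $\ell_k\to\infty$. Let $\Pi_L=\mathrm{span}_{\mathbb C}\{\phi_j:\ell_j\le L\}$, and suppose that every $\Pi_L$ is closed under complex conjugation (this is automatic if the $\phi_k$ are real-valued). The system is called *admissible* if the following hold. 1. The heat kernel $K_t(x,y)=\sum_{k}\exp(-\ell_k^2t)\phi_k(x)\overline{\phi_k(y)}$ converges for all $x,y\in\mathbb X$, $t\in(0,1]$, is differentiable in $y$, and satisfies, for all $x,y\in\mathbb X$ and $t\in(0,1]$, $$|K_t(x,y)|\le\kappa_2t^{-\alpha/2}e^{-\kappa_3\rho(x,y)^2/t},\qquad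 \|\nabla_yK_t(x,y)\|_y\le\kappa_2t^{-\alpha/2-1}e^{-\kappa_3\rho(x,y)^2/t},\qquad K_t(x,x)\ge\kappa_4t^{-\alpha/2}.$$ 2. The $\phi_k$ are differentiable, and for every smooth vector field $F$ on $\mathbb X$ the system $\psi_k=F\phi_k$ is a Bessel system, that is, $\psi_k\in L^2(\mu)$ for all $k$ and there is a set $\mathcal D\subset C(\mathbb X)$, dense with respect to the norm $\|\cdot\|_{L^1(\mu)}+\|\cdot\|_{L^\infty(\mu)}$, such that (i) for every $\epsilon>0$, every ball $B(x,r)$ and every $f\in C(\mathbb X)$ supported on $B(x,r)$ there is $g\in\mathcal D$ supported on $B(x,2r)$ with $\|f-g\|_{L^1(\mu)}\le\epsilon$, and (ii) $\sum_k|\langle f,\psi_k\rangle|^2<\infty$ for every $f\in\mathcal D$. Put $$\epsilon_L=\sup_{\ell_j,\ell_k\le L}\ \inf_{Q\in\Pi_{A^*L}}\|\phi_j\phi_k-Q\|_{L^\infty(\mu)},\qquad L>0.$$ The *product assumption* is that $L^s\epsilon_L\to0$ as $L\to\infty$ for every $s>0$. **Theorem.** For every $p\in[1,\infty)$ there are constants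 $c_1(p),c_2(p)>0$, depending only on $p$, $\mathbb X$, $\rho$, $\mu$, $\alpha$, $\kappa_1,\dots,\kappa_4$ and $A^*$ (not on $\{\phi_k\}$ or $\{\ell_k\}$), with the following property. Let $e:\mathbb R\to[0,\infty]$ be any function with $L^se(L)\to0$ as $L\to\infty$ for every $s>0$. Then there is $c>0$, depending only on $\mathbb X$, $\rho$, $\mu$, $\alpha$, $\kappa_1,\dots,\kappa_4$, $A^*$ and $e$ (in particular not on $p$), such that for every admissible system with $\epsilon_L\le e(L)$ for all $L>0$ (every admissible system satisfying the product assumption is covered, with $e(L)=\epsilon_L$ for $L>0$ and $e(L)=0$ otherwise), for every real $L\ge c$, and for every positive finite Borel measure $\tau$ on $\mathbb X$ that is a quadrature measure of order $2A^*L$, i.e. $\int P\,d\mu=\int P\,d\tau$ for all $P\in\Pi_{2A^*L}$, we have $$c_1(p)\,\|P\|_{\mu;p}\le\|P\|_{\tau;p}\le c_2(p)\,\|P\|_{\mu;p}\qquad\text{for all }P\in\Pi_L,\ 1\le p<\infty,$$ where $\|f\|_{\nu;p}=\bigl(\int|f|^p\,d\nu\bigr)^{1/p}$. -/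

import Mathlib

open Set Filter Topology MeasureTheory Bundle Manifold
open scoped ENNReal NNReal ContDiff ComplexConjugate

/-! ## Diffusion polynomials and the product assumption -/

section Polynomials

variable {M : Type*}

/-- The space `Π_L` of diffusion polynomials of degree at most `L`:
the complex span of the `φ j` with `ℓ j ≤ L`. -/
def diffusionPoly (φ : ℕ → M → ℂ) (ℓ : ℕ → ℝ) (L : ℝ) : Submodule ℂ (M → ℂ) :=
  Submodule.span ℂ (φ '' {j | ℓ j ≤ L})

variable [MeasurableSpace M]

/-- `dist(p; f, V) = inf_{P ∈ V} ‖f - P‖_{μ;p}`. -/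
noncomputable def lpDist (μ : Measure M) (p : ℝ≥0∞) (f : M → ℂ) (V : Submodule ℂ (M → ℂ)) :
    ℝ≥0∞ :=
  ⨅ P ∈ V, eLpNorm (f - P) p μ

/-- `ε_L = sup {dist(∞; φ_j φ_k, Π_{A L}) : ℓ_j ≤ L, ℓ_k ≤ L}`. -/
noncomputable def productError (μ : Measure M) (φ : ℕ → M → ℂ) (ℓ : ℕ → ℝ) (A L : ℝ) : ℝ≥0∞ :=
  ⨆ (j : ℕ) (k : ℕ) (_ : ℓ j ≤ L) (_ : ℓ k ≤ L),
    lpDist μ ∞ (φ j * φ k) (diffusionPoly φ ℓ (A * L))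

/-- `L ^ s * e L → 0` as `L → ∞`, for every `s > 0`. The product assumption with constant `A` says
that `productError μ φ ℓ A` has this property. -/
def RapidlyDecreasing (e : ℝ → ℝ≥0∞) : Prop :=
  ∀ s : ℝ, 0 < s → Tendsto (fun L : ℝ => ENNReal.ofReal (L ^ s) * e L) atTop (𝓝 0)

/-- `ν` is a quadrature measure of order `L` (with respect to `μ`). -/
def IsQuadratureMeasure (μ : Measure M) (φ : ℕ → M → ℂ) (ℓ : ℕ → ℝ) (L : ℝ) (ν : Measure M) :
    Prop :=
  ∀ P ∈ diffusionPoly φ ℓ L, ∫ y, P y ∂μ = ∫ y, P y ∂ν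

/-- The standing conditions on `{φ_k}` and `{ℓ_k}`. The condition `conj_mem` is automatic for
real-valued `φ_k`. -/
structure IsDiffusionSystem [TopologicalSpace M] (μ : Measure M) (φ : ℕ → M → ℂ) (ℓ : ℕ → ℝ) :
    Prop where
  continuous : ∀ k, Continuous (φ k)
  orthonormal : ∀ j k, ∫ x, φ j x * conj (φ k x) ∂μ = if j = k then 1 else 0
  phi_zero : ∀ x, φ 0 x = 1
  ell_zero : ℓ 0 = 1
  ell_mono : Monotone ℓ
  ell_tendsto : Tendsto ℓ atTop atTop
  conj_mem : ∀ L : ℝ, ∀ P ∈ diffusionPoly φ ℓ L, (fun x => conj (P x)) ∈ diffusionPoly φ ℓ L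

end Polynomials

/-! ## The assumptions on the measure, the heat kernel and the derivatives -/

/-- `K_t(x, y) = ∑ₖ exp(-ℓ_k² t) φ_k(x) conj(φ_k(y))`. -/
noncomputable def heatKernel {M : Type*} (φ : ℕ → M → ℂ) (ℓ : ℕ → ℝ) (t : ℝ) (x y : M) : ℂ :=
  ∑' k, (Real.exp (-(ℓ k) ^ 2 * t) : ℂ) * (φ k x * conj (φ k y))

/-- `μ(B(x, r)) ≤ κ₁ r ^ α` for all closed balls. -/
def BallMeasureBound {M : Type*} [MetricSpace M] [MeasurableSpace M] (μ : Measure M)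
    (α κ₁ : ℝ) : Prop :=
  ∀ x : M, ∀ r : ℝ, 0 < r → μ.real (Metric.closedBall x r) ≤ κ₁ * r ^ α

/-- The derivative of `f` at `x` in the direction of the tangent vector `v`. -/
noncomputable def tangentDeriv {q : ℕ} {M : Type*} [TopologicalSpace M]
    [ChartedSpace (EuclideanSpace ℝ (Fin q)) M] (f : M → ℂ) (x : M)
    (v : TangentSpace (𝓡 q) x) : ℂ :=
  mfderiv (𝓡 q) 𝓘(ℝ, ℂ) f x v

/-- The Gaussian upper bounds for the heat kernel and its gradient, and the lower bound on the
diagonal. The norm of the gradient at `y` is the norm of the differential as a functional on the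
tangent space at `y` with its Riemannian norm. -/
structure HeatKernelBounds {q : ℕ} {M : Type*} [MetricSpace M]
    [ChartedSpace (EuclideanSpace ℝ (Fin q)) M]
    [RiemannianBundle (fun x : M => TangentSpace (𝓡 q) x)]
    (α κ₂ κ₃ κ₄ : ℝ) (φ : ℕ → M → ℂ) (ℓ : ℕ → ℝ) : Prop where
  summable : ∀ t ∈ Ioc (0 : ℝ) 1, ∀ x y : M,
    Summable fun k => (Real.exp (-(ℓ k) ^ 2 * t) : ℂ) * (φ k x * conj (φ k y))
  upper : ∀ t ∈ Ioc (0 : ℝ) 1, ∀ x y : M,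
    ‖heatKernel φ ℓ t x y‖ ≤ κ₂ * t ^ (-α / 2) * Real.exp (-κ₃ * dist x y ^ 2 / t)
  differentiable : ∀ t ∈ Ioc (0 : ℝ) 1, ∀ x : M,
    MDifferentiable (𝓡 q) 𝓘(ℝ, ℂ) (fun y => heatKernel φ ℓ t x y)
  gradient : ∀ t ∈ Ioc (0 : ℝ) 1, ∀ x y : M, ∀ v : TangentSpace (𝓡 q) y,
    ‖tangentDeriv (fun z => heatKernel φ ℓ t x z) y v‖ ≤
      κ₂ * t ^ (-α / 2 - 1) * Real.exp (-κ₃ * dist x y ^ 2 / t) * ‖v‖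
  lower : ∀ t ∈ Ioc (0 : ℝ) 1, ∀ x : M, κ₄ * t ^ (-α / 2) ≤ (heatKernel φ ℓ t x x).re

/-- Bessel systems in `L²(μ)`; the space `𝒟` is a set of continuous functions (every continuous
function on the compact space `M` is integrable). -/
def IsBesselSystem {M : Type*} [MetricSpace M] [MeasurableSpace M] (μ : Measure M)
    (ψ : ℕ → M → ℂ) : Prop :=
  (∀ k, MemLp (ψ k) 2 μ) ∧
  ∃ D : Set C(M, ℂ),
    (∀ f : C(M, ℂ), ∀ ε : ℝ≥0∞, 0 < ε →
      ∃ g ∈ D, eLpNorm (⇑f - ⇑g) 1 μ + eLpNorm (⇑f - ⇑g) ∞ μ < ε) ∧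
    (∀ ε : ℝ≥0∞, 0 < ε → ∀ (x : M) (r : ℝ), 0 < r →
      ∀ f : C(M, ℂ), tsupport f ⊆ Metric.closedBall x r →
        ∃ g ∈ D, tsupport g ⊆ Metric.closedBall x (2 * r) ∧ eLpNorm (⇑f - ⇑g) 1 μ ≤ ε) ∧
    (∀ f ∈ D, Summable fun k => ‖∫ x, f x * conj (ψ k x) ∂μ‖ ^ 2)

/-- For every smooth vector field `F`, the system `{F φ_k}` is a Bessel system. -/
structure BesselAssumption {q : ℕ} {M : Type*} [MetricSpace M]
    [ChartedSpace (EuclideanSpace ℝ (Fin q)) M] [IsManifold (𝓡 q) ∞ M]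
    [MeasurableSpace M] (μ : Measure M) (φ : ℕ → M → ℂ) : Prop where
  differentiable : ∀ k, MDifferentiable (𝓡 q) 𝓘(ℝ, ℂ) (φ k)
  bessel : ∀ F : (x : M) → TangentSpace (𝓡 q) x,
    ContMDiff (𝓡 q) (𝓡 q).tangent ∞ (fun x => (⟨x, F x⟩ : TangentBundle (𝓡 q) M)) →
    IsBesselSystem μ (fun k x => tangentDeriv (φ k) x (F x))

/-! Let `cutoffKernel` at level L be the sum of H(ℓ_k / L) φ_k(x) conj(φ_k(y)), with H a smooth
cutoff equal to 1 on [0, 1] and to 0 on [2, ∞). Integration against it with respect to μ reproduces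
Π_L. If the kernel is concentrated at scale 1/L, Schur's test bounds the same integral operator
between L^p spaces of any two measures whose balls of radius r ≥ 1/L have mass O(r^α). Reproduction
under μ, measured in L^p(τ), gives the upper inequality. For the lower one, μ is replaced by τ in
the reproducing formula. The integrand is a product of two elements of Π_{2L}, which the product
assumption approximates from Π_{2AL}, where τ is exact. The error is ε_{2L} times a power of L,
hence at most half of ‖P‖_{μ;1} for large L, and is absorbed.

Localization (`exists_norm_cutoffKernel_le`): write H(s) = v g(v) with v = exp(-s²) and replace g by
a polynomial of degree n. The kernel becomes a combination of heat kernels at times (j+1)/L², j ≤ n,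
plus a remainder bounded through the diagonal. Taking n proportional to L·dist(x, y), the Gaussian
decay beats the growth 7^n of the coefficients, and the remainder is smaller than any prescribed
power.

Regularity of τ (`isRegularMeasure_of_quadrature`): the diagonal lower bound forces a fixed share of
the L²(μ) norm of the kernel at level 1/r into a ball of radius comparable with r. Integrating this
local energy over y in a ball against τ and exchanging the integrals, the squared kernel is
integrated by τ almost as by μ, which bounds the τ-mass of the ball.

All these constants are fixed before the system is chosen and do not involve e; the rate e only
affects how large L must be. -/

/-! ## Polynomial approximation of smooth functions -/

section Approximation

/-- The Fourier coefficients of a smooth periodic function decay rapidly. -/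
theorem exists_fourierCoeffOn_decay (S : ℕ) :
    ∀ F : ℝ → ℂ, ContDiff ℝ ∞ F → Function.Periodic F (2 * Real.pi) →
      ∃ C : ℝ, 0 ≤ C ∧ ∀ n : ℤ,
        |(n : ℝ)| ^ S * ‖fourierCoeffOn (lt_add_of_pos_right 0 Real.two_pi_pos) F n‖ ≤ C := by
  induction S with
  | zero =>
    intro F hF hper
    obtain ⟨C, hC⟩ := (isCompact_Icc (a := (0 : ℝ)) (b := 0 + 2 * Real.pi)).exists_bound_of_continuousOn
      hF.continuous.continuousOn
    have hC0 : 0 ≤ C := (norm_nonneg _).trans (hC 0 ⟨le_rfl, by positivity⟩)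
    refine ⟨C, hC0, fun n => ?_⟩
    rw [pow_zero, one_mul, fourierCoeffOn_eq_integral, norm_smul]
    have h1 : ‖∫ x in (0 : ℝ)..0 + 2 * Real.pi,
        fourier (-n) (x : AddCircle (0 + 2 * Real.pi - 0)) • F x‖ ≤
          C * |0 + 2 * Real.pi - 0| := by
      refine intervalIntegral.norm_integral_le_of_norm_le_const fun x hx => ?_
      rw [uIoc_of_le (by positivity)] at hx
      rw [norm_smul, fourier_apply, Circle.norm_coe, one_mul]
      exact hC x ⟨hx.1.le, hx.2⟩
    have hpi := Real.pi_pos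
    simp only [zero_add, sub_zero, abs_of_pos Real.two_pi_pos] at h1 ⊢
    calc _ ≤ ‖1 / (2 * Real.pi)‖ * (C * (2 * Real.pi)) := by gcongr
      _ = C := by
        rw [Real.norm_of_nonneg (by positivity)]
        field_simp
  | succ S ih =>
    intro F hF hper
    have hdF : ContDiff ℝ ∞ (deriv F) := (contDiff_infty_iff_deriv.mp hF).2
    have hdper : Function.Periodic (deriv F) (2 * Real.pi) := fun x => by
      rw [← deriv_comp_add_const]
      congr 1
      exact funext hper
    obtain ⟨C, hC0, hC⟩ := ih (deriv F) hdF hdper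
    refine ⟨C, hC0, fun n => ?_⟩
    rcases eq_or_ne n 0 with rfl | hn
    · simpa using hC0
    have hd : ∀ x, HasDerivAt F (deriv F x) x := fun x =>
      ((contDiff_infty_iff_deriv.mp hF).1 x).hasDerivAt
    -- Integration by parts; periodicity kills the boundary term. Since c_n(F') = i n c_n(F), the
    -- constant for F' serves F unchanged.
    rw [fourierCoeffOn_of_hasDerivAt _ hn (fun x _ => hd x)
      (hdF.continuous.intervalIntegrable _ _), hper 0, sub_self, mul_zero, zero_sub]
    have hn' : (0 : ℝ) < |(n : ℝ)| := abs_pos.mpr (by exact_mod_cast hn)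
    have hpi := Real.pi_pos
    refine le_trans (le_of_eq ?_) (hC n)
    simp only [norm_mul, norm_neg, norm_div, norm_one, Complex.norm_I, Complex.norm_real,
      Complex.norm_intCast, Complex.norm_ofNat, Real.norm_of_nonneg hpi.le, zero_add, sub_zero,
      Complex.ofReal_mul, Complex.ofReal_ofNat, Complex.ofReal_zero, mul_one]
    field_simp
    ring

/-- `p` is a real polynomial function of degree at most `n`
whose coefficients have absolute sum at most `B`. -/
def IsPolyBound (n : ℕ) (B : ℝ) (p : ℝ → ℝ) : Prop :=
  ∃ b : ℕ → ℝ, (∀ v, p v = ∑ j ∈ Finset.range (n + 1), b j * v ^ j) ∧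
    ∑ j ∈ Finset.range (n + 1), |b j| ≤ B

/-! ### Arithmetic of polynomials with controlled coefficients. -/

namespace IsPolyBound

variable {n m : ℕ} {B B' : ℝ} {p p' : ℝ → ℝ}

theorem mono (h : IsPolyBound n B p) (hnm : n ≤ m) (hB : B ≤ B') : IsPolyBound m B' p := by
  obtain ⟨b, hb, hB1⟩ := h
  have hsub : Finset.range (n + 1) ⊆ Finset.range (m + 1) := by
    intro j; simp only [Finset.mem_range]; omega
  refine ⟨fun j => if j ≤ n then b j else 0, fun v => ?_, ?_⟩
  · rw [hb, ← Finset.sum_subset hsub]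
    · refine Finset.sum_congr rfl fun j hj => ?_
      beta_reduce
      rw [if_pos (by simpa [Nat.lt_succ_iff] using hj)]
    · intro j _ hj
      beta_reduce
      rw [if_neg (by simpa [Nat.lt_succ_iff] using hj), zero_mul]
  · refine le_trans (le_of_eq ?_) (hB1.trans hB)
    rw [← Finset.sum_subset hsub]
    · refine Finset.sum_congr rfl fun j hj => ?_
      beta_reduce
      rw [if_pos (by simpa [Nat.lt_succ_iff] using hj)]
    · intro j _ hj
      beta_reduce
      rw [if_neg (by simpa [Nat.lt_succ_iff] using hj), abs_zero]

theorem add (h : IsPolyBound n B p) (h' : IsPolyBound n B' p') :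
    IsPolyBound n (B + B') (fun v => p v + p' v) := by
  obtain ⟨b, hb, hB⟩ := h
  obtain ⟨b', hb', hB'⟩ := h'
  refine ⟨fun j => b j + b' j, fun v => ?_, ?_⟩
  · beta_reduce
    rw [hb, hb', ← Finset.sum_add_distrib]
    exact Finset.sum_congr rfl fun j _ => by ring
  · refine (Finset.sum_le_sum fun j _ => abs_add_le _ _).trans ?_
    rw [Finset.sum_add_distrib]
    exact add_le_add hB hB'

theorem const_mul (h : IsPolyBound n B p) (c : ℝ) :
    IsPolyBound n (|c| * B) (fun v => c * p v) := by
  obtain ⟨b, hb, hB⟩ := h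
  refine ⟨fun j => c * b j, fun v => ?_, ?_⟩
  · beta_reduce
    rw [hb, Finset.mul_sum]
    exact Finset.sum_congr rfl fun j _ => by ring
  · simp_rw [abs_mul, ← Finset.mul_sum]
    gcongr

theorem id_mul (h : IsPolyBound n B p) : IsPolyBound (n + 1) B (fun v => v * p v) := by
  obtain ⟨b, hb, hB⟩ := h
  refine ⟨fun j => if j = 0 then 0 else b (j - 1), fun v => ?_, ?_⟩
  · beta_reduce
    rw [Finset.sum_range_succ', hb, Finset.mul_sum]
    simp only [Nat.add_eq_zero_iff, one_ne_zero, and_false, if_false, if_true, zero_mul, add_zero,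
      Nat.add_sub_cancel]
    exact Finset.sum_congr rfl fun j _ => by ring
  · rw [Finset.sum_range_succ']
    simpa using hB

theorem const (c : ℝ) : IsPolyBound 0 |c| (fun _ => c) := ⟨fun _ => c, by simp, by simp⟩

theorem sum {ι : Type*} (s : Finset ι) (B : ι → ℝ) (p : ι → ℝ → ℝ)
    (h : ∀ i ∈ s, IsPolyBound n (B i) (p i)) :
    IsPolyBound n (∑ i ∈ s, B i) (fun v => ∑ i ∈ s, p i v) := by
  classical
  induction s using Finset.induction_on with
  | empty =>
    simpa using (const 0).mono (Nat.zero_le n) le_rfl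
  | insert a s ha ih =>
    simp only [Finset.sum_insert ha]
    exact (h a (Finset.mem_insert_self a s)).add
      (ih fun i hi => h i (Finset.mem_insert_of_mem hi))

end IsPolyBound

/-- The Chebyshev polynomial of degree `k` on `[0, 1]` has coefficients summing to at most `7 ^ k`
in absolute value. -/
theorem isPolyBound_chebyshev (k : ℕ) :
    IsPolyBound k (7 ^ k) (fun v => (Polynomial.Chebyshev.T ℝ k).eval (2 * v - 1)) := by
  induction k using Nat.twoStepInduction with
  | zero => simpa using IsPolyBound.const 1
  | one =>
    have h : IsPolyBound 1 (|2| * |1| + |-1|) (fun v : ℝ => 2 * (v * 1) + -1) :=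
      ((IsPolyBound.const 1).id_mul.const_mul 2).add ((IsPolyBound.const (-1)).mono zero_le_one le_rfl)
    have e : (fun v : ℝ => (Polynomial.Chebyshev.T ℝ (1 : ℕ)).eval (2 * v - 1)) =
        fun v => 2 * (v * 1) + -1 := by
      funext v
      simp
      ring
    rw [e]
    exact h.mono le_rfl (by norm_num)
  | more k h0 h1 =>
    -- In the variable 2v - 1 the three-term recurrence gives coefficient sum at most (4 +
    -- 2)·7^(k+1) + 7^k = 43·7^k, below 49·7^k.
    have h := ((h1.id_mul.const_mul 4).add ((h1.const_mul (-2)).mono (Nat.le_succ _) le_rfl)).add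
      ((h0.const_mul (-1)).mono (show k ≤ k + 1 + 1 by omega) le_rfl)
    have e : (fun v : ℝ => (Polynomial.Chebyshev.T ℝ (k + 2 : ℕ)).eval (2 * v - 1)) = fun v =>
        4 * (v * (Polynomial.Chebyshev.T ℝ (k + 1 : ℕ)).eval (2 * v - 1)) +
          -2 * (Polynomial.Chebyshev.T ℝ (k + 1 : ℕ)).eval (2 * v - 1) +
          -1 * (Polynomial.Chebyshev.T ℝ k).eval (2 * v - 1) := by
      funext v
      push_cast
      rw [Polynomial.Chebyshev.T_add_two]
      simp
      ring
    rw [e]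
    refine h.mono le_rfl ?_
    have : (0 : ℝ) ≤ 7 ^ k := by positivity
    norm_num [pow_succ]
    linarith

/-- Jackson-type approximation: a smooth function on `[0, 1]` is approximated by polynomials of
degree `n` to any inverse power of `n`, with coefficients growing at most like `7 ^ n`. -/
theorem exists_isPolyBound_approx {g : ℝ → ℝ} (hg : ContDiff ℝ ∞ g) (S : ℕ) :
    ∃ C : ℝ, 0 < C ∧ ∀ n : ℕ, ∃ q : ℝ → ℝ, IsPolyBound n (C * 7 ^ n) q ∧
      ∀ v ∈ Icc (0 : ℝ) 1, |g v - q v| ≤ C / (n + 1) ^ S := by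
  -- The substitution v = (1 + cos θ)/2 makes g smooth, periodic and even. As cos kθ = T_k(2v - 1),
  -- truncating the Fourier series at n leaves a polynomial of degree at most n in v.
  set F : ℝ → ℂ := fun θ => (g ((1 + Real.cos θ) / 2) : ℂ) with hFdef
  have hF : ContDiff ℝ ∞ F := Complex.ofRealCLM.contDiff.comp
    (hg.comp ((contDiff_const.add Real.contDiff_cos).div_const 2))
  have hper : Function.Periodic F (2 * Real.pi) := fun x => by
    simp only [hFdef, Real.cos_add_two_pi]
  have : Fact (0 < 2 * Real.pi) := ⟨Real.two_pi_pos⟩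
  -- Two powers beyond S make the tail summable: 1/k² is summed, and 1/|k|^S gives the rate.
  obtain ⟨C₀, hC₀, hdecay⟩ := exists_fourierCoeffOn_decay (S + 2) F hF hper
  set c : ℤ → ℂ := fourierCoeffOn (lt_add_of_pos_right 0 Real.two_pi_pos) F with hc
  let Fc : C(AddCircle (2 * Real.pi), ℂ) :=
    ⟨hper.lift, by
      exact continuous_coinduced_dom.mpr hF.continuous⟩
  have hFc : fourierCoeff Fc = c := by
    funext n
    rw [hc, ← fourierCoeff_liftIoc_eq]
    congr 1
    funext x
    obtain ⟨y, hy, rfl⟩ := (AddCircle.coe_image_Ioc_eq (2 * Real.pi) 0).symm ▸ mem_univ x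
    rw [AddCircle.liftIoc_coe_apply hy]
    rfl
  have hsq : Summable fun k : ℤ => 1 / (k : ℝ) ^ 2 :=
    Real.summable_one_div_int_pow.mpr one_lt_two
  have hck : ∀ (k : ℤ), k ≠ 0 → ‖c k‖ ≤ C₀ / |(k : ℝ)| ^ S * (1 / (k : ℝ) ^ 2) := by
    intro k hk
    have hk' : (0 : ℝ) < |(k : ℝ)| := abs_pos.mpr (by exact_mod_cast hk)
    have h := hdecay k
    rw [div_mul_div_comm, mul_one, ← sq_abs, ← pow_add, le_div_iff₀ (by positivity), mul_comm]
    exact h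
  have hck' : ∀ k : ℤ, k ≠ 0 → ‖c k‖ ≤ C₀ * (1 / (k : ℝ) ^ 2) := by
    intro k hk
    refine (hck k hk).trans ?_
    have hk' : (1 : ℝ) ≤ |(k : ℝ)| := by exact_mod_cast Int.one_le_abs hk
    gcongr
    exact div_le_self hC₀ (one_le_pow₀ hk')
  have hsum : Summable c := by
    refine Summable.of_norm_bounded_eventually (hsq.mul_left C₀) ?_
    filter_upwards [(Set.finite_singleton (0 : ℤ)).compl_mem_cofinite] with k hk
    exact hck' k hk
  have hcos : ∀ θ : ℝ, HasSum (fun k : ℤ => (c k).re * Real.cos (k * θ))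
      (g ((1 + Real.cos θ) / 2)) := by
    intro θ
    have h : ∀ x : ℝ, HasSum (fun k : ℤ => c k * Complex.exp (k * x * Complex.I)) (F x) := by
      intro x
      have := has_pointwise_sum_fourier_series_of_summable (f := Fc) (hFc ▸ hsum)
        (x : AddCircle (2 * Real.pi))
      rw [hFc] at this
      refine this.congr_fun fun k => ?_
      rw [fourier_coe_apply, smul_eq_mul]
      congr 2
      push_cast
      field_simp
    -- F is even, so averaging the series at θ and -θ turns exponentials into cosines without
    -- changing the sum.
    have h2 := ((h θ).add (h (-θ))).mul_left (1 / 2)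
    have h3 := Complex.hasSum_re h2
    have e : (1 / 2 * (F θ + F (-θ))).re = g ((1 + Real.cos θ) / 2) := by
      simp only [hFdef, Real.cos_neg]
      rw [← two_mul, ← mul_assoc]
      norm_num
    rw [e] at h3
    refine h3.congr_fun fun k => ?_
    have : 1 / 2 * (c k * Complex.exp (k * (θ : ℝ) * Complex.I) +
        c k * Complex.exp (k * ((-θ : ℝ) : ℂ) * Complex.I)) = c k * (Real.cos (k * θ) : ℝ) := by
      push_cast
      rw [Complex.cos]
      ring_nf
    rw [this, Complex.re_mul_ofReal]
  set Z : ℝ := ∑' k : ℤ, 1 / (k : ℝ) ^ 2 with hZ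
  have hZ0 : 0 ≤ Z := tsum_nonneg fun k => by positivity
  set W : ℝ := ∑' k : ℤ, ‖c k‖ with hW
  have hW0 : 0 ≤ W := tsum_nonneg fun k => by positivity
  refine ⟨W + C₀ * Z + 1, by positivity, fun n => ⟨fun v => ∑ k ∈ Finset.Icc (-n : ℤ) n,
    (c k).re * (Polynomial.Chebyshev.T ℝ k.natAbs).eval (2 * v - 1), ?_, ?_⟩⟩
  · refine (IsPolyBound.sum (n := n) _ (fun k => |(c k).re| * 7 ^ n) _ fun k hk => ?_).mono le_rfl ?_
    · have hkn : k.natAbs ≤ n := by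
        rw [Finset.mem_Icc] at hk
        omega
      refine ((isPolyBound_chebyshev k.natAbs).const_mul _).mono hkn ?_
      gcongr
      norm_num
    · rw [← Finset.sum_mul]
      gcongr
      calc ∑ k ∈ Finset.Icc (-n : ℤ) n, |(c k).re| ≤ ∑ k ∈ Finset.Icc (-n : ℤ) n, ‖c k‖ :=
            Finset.sum_le_sum fun k _ => Complex.abs_re_le_norm _
        _ ≤ W := hsum.norm.sum_le_tsum _ fun k _ => norm_nonneg _
        _ ≤ W + C₀ * Z + 1 := by nlinarith [mul_nonneg hC₀ hZ0]
  · intro v hv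
    set θ := Real.arccos (2 * v - 1) with hθ
    have hcosθ : Real.cos θ = 2 * v - 1 :=
      Real.cos_arccos (by linarith [hv.1]) (by linarith [hv.2])
    have hs := hcos θ
    rw [hcosθ, show (1 + (2 * v - 1)) / 2 = v by ring] at hs
    set s := Finset.Icc (-n : ℤ) n with hsdef
    have hq : ∑ k ∈ s, (c k).re * (Polynomial.Chebyshev.T ℝ k.natAbs).eval (2 * v - 1) =
        ∑ k ∈ s, (c k).re * Real.cos (k * θ) := by
      refine Finset.sum_congr rfl fun k _ => ?_
      rw [← hcosθ, Polynomial.Chebyshev.T_real_cos]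
      congr 1
      rcases Int.natAbs_eq k with h | h <;> conv_rhs => rw [h]
      push_cast
      rw [neg_mul, Real.cos_neg]
    have hrest := (s.hasSum_compl_iff (f := fun k : ℤ => (c k).re * Real.cos (k * θ))
      (a := g v - ∑ k ∈ s, (c k).re * Real.cos (k * θ))).mpr (by simpa using hs)
    beta_reduce
    rw [hq, ← hrest.tsum_eq, ← Real.norm_eq_abs]
    have hbd : Summable fun k : {k : ℤ // k ∉ s} => C₀ / (n + 1) ^ S * (1 / ((k : ℤ) : ℝ) ^ 2) :=
      (hsq.subtype _).mul_left _
    refine (tsum_of_norm_bounded hbd.hasSum fun k => ?_).trans ?_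
    · have hk : (n : ℤ) + 1 ≤ |(k : ℤ)| := by
        have : ¬(-(n : ℤ) ≤ k ∧ (k : ℤ) ≤ n) := fun h' => k.2 (Finset.mem_Icc.mpr h')
        rcases abs_cases (k : ℤ) with h | h <;> omega
      have hk0 : (k : ℤ) ≠ 0 := by
        rintro h
        rw [h, abs_zero] at hk
        omega
      have hk' : (n : ℝ) + 1 ≤ |((k : ℤ) : ℝ)| := by exact_mod_cast hk
      have h1 : ‖(c k).re * Real.cos ((k : ℤ) * θ)‖ ≤ ‖c k‖ := by
        rw [norm_mul]
        calc _ ≤ ‖c k‖ * 1 := mul_le_mul (Complex.abs_re_le_norm _) (Real.abs_cos_le_one _)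
              (abs_nonneg _) (norm_nonneg _)
          _ = _ := mul_one _
      refine h1.trans ((hck k hk0).trans ?_)
      gcongr
    · rw [tsum_mul_left]
      have : ∑' k : {k : ℤ // k ∉ s}, 1 / ((k : ℤ) : ℝ) ^ 2 ≤ Z :=
        hsq.tsum_subtype_le (fun k : ℤ => 1 / (k : ℝ) ^ 2) {k | k ∉ s} (fun k => by positivity)
      calc _ ≤ C₀ / (n + 1) ^ S * Z := by gcongr
        _ = (C₀ * Z) / (n + 1) ^ S := by ring
        _ ≤ _ := by gcongr; linarith

end Approximation

/-! ## The localized kernel -/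

section Cutoff

/-- A smooth function on the line that equals `1 / v` for `v ≥ exp (-1)` and vanishes for
`v ≤ exp (-4)`. -/
noncomputable def cutoffQuotient (v : ℝ) : ℝ :=
  Real.smoothTransition ((v - Real.exp (-4)) / (Real.exp (-1) - Real.exp (-4))) / v

theorem exp_neg_four_lt : Real.exp (-4) < Real.exp (-1) := Real.exp_lt_exp.mpr (by norm_num)

theorem cutoffQuotient_eq_zero {v : ℝ} (hv : v ≤ Real.exp (-4)) : cutoffQuotient v = 0 := by
  have h := exp_neg_four_lt
  rw [cutoffQuotient, Real.smoothTransition.zero_of_nonpos, zero_div]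
  exact div_nonpos_of_nonpos_of_nonneg (by linarith) (by linarith)

/-- The denominator does no harm: the numerator vanishes to the left of exp(-4), a neighbourhood of
every v ≤ 0. -/
theorem contDiff_cutoffQuotient : ContDiff ℝ ∞ cutoffQuotient := by
  rw [contDiff_iff_contDiffAt]
  intro v
  rcases lt_or_ge 0 v with hv | hv
  · refine ContDiffAt.div ?_ contDiffAt_id hv.ne'
    exact (Real.smoothTransition.contDiff.comp
      ((contDiff_id.sub contDiff_const).div_const _)).contDiffAt
  · refine (contDiffAt_const (c := (0 : ℝ))).congr_of_eventuallyEq ?_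
    filter_upwards [Iio_mem_nhds (hv.trans_lt (Real.exp_pos (-4)))] with w hw
    exact cutoffQuotient_eq_zero hw.le

/-- The spectral cutoff: equal to `1` on `[0, 1]` and to `0` on `[2, ∞)`. -/
noncomputable def spectralCutoff (s : ℝ) : ℝ :=
  Real.exp (-s ^ 2) * cutoffQuotient (Real.exp (-s ^ 2))

theorem spectralCutoff_eq (s : ℝ) : spectralCutoff s = Real.smoothTransition
    ((Real.exp (-s ^ 2) - Real.exp (-4)) / (Real.exp (-1) - Real.exp (-4))) := by
  rw [spectralCutoff, cutoffQuotient, mul_div_cancel₀ _ (Real.exp_pos _).ne']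

theorem spectralCutoff_eq_one {s : ℝ} (h0 : 0 ≤ s) (h1 : s ≤ 1) : spectralCutoff s = 1 := by
  have h := exp_neg_four_lt
  rw [spectralCutoff_eq]
  apply Real.smoothTransition.one_of_one_le
  rw [one_le_div (by linarith)]
  have : Real.exp (-1) ≤ Real.exp (-s ^ 2) := Real.exp_le_exp.mpr (by nlinarith)
  linarith

theorem spectralCutoff_eq_zero {s : ℝ} (h : 2 ≤ s) : spectralCutoff s = 0 := by
  rw [spectralCutoff, cutoffQuotient_eq_zero, mul_zero]
  exact Real.exp_le_exp.mpr (by nlinarith)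

end Cutoff

section Kernel

variable {M : Type*} {φ : ℕ → M → ℂ} {ℓ : ℕ → ℝ}

/-- The localized kernel `∑ₖ H(ℓ_k / L) φ_k(x) conj(φ_k(y))`, where `H` is the spectral cutoff. -/
noncomputable def cutoffKernel (φ : ℕ → M → ℂ) (ℓ : ℕ → ℝ) (L : ℝ) (x y : M) : ℂ :=
  ∑' k, (spectralCutoff (ℓ k / L) : ℂ) * (φ k x * conj (φ k y))

/-- The size conditions on the heat kernel, without those on its gradient. -/
structure GaussianBounds [MetricSpace M] (α κ₂ κ₃ κ₄ : ℝ) (φ : ℕ → M → ℂ) (ℓ : ℕ → ℝ) :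
    Prop where
  summable : ∀ t ∈ Ioc (0 : ℝ) 1, ∀ x y : M,
    Summable fun k => (Real.exp (-(ℓ k) ^ 2 * t) : ℂ) * (φ k x * conj (φ k y))
  upper : ∀ t ∈ Ioc (0 : ℝ) 1, ∀ x y : M,
    ‖heatKernel φ ℓ t x y‖ ≤ κ₂ * t ^ (-α / 2) * Real.exp (-κ₃ * dist x y ^ 2 / t)
  lower : ∀ t ∈ Ioc (0 : ℝ) 1, ∀ x : M, κ₄ * t ^ (-α / 2) ≤ (heatKernel φ ℓ t x x).re

namespace GaussianBounds

variable [MetricSpace M] {α κ₂ κ₃ κ₄ t : ℝ}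

/-- On the diagonal the series has nonnegative terms, so heat kernel bounds become bounds for sums
of |φ_k(x)|². -/
theorem hasSum_diag (h : GaussianBounds α κ₂ κ₃ κ₄ φ ℓ) (ht : t ∈ Ioc (0 : ℝ) 1) (x : M) :
    HasSum (fun k => Real.exp (-(ℓ k) ^ 2 * t) * ‖φ k x‖ ^ 2) (heatKernel φ ℓ t x x).re := by
  refine (Complex.hasSum_re (h.summable t ht x x).hasSum).congr_fun fun k => ?_
  rw [Complex.mul_conj, Complex.normSq_eq_norm_sq, Complex.re_ofReal_mul, Complex.ofReal_re]

theorem diag_le (h : GaussianBounds α κ₂ κ₃ κ₄ φ ℓ) (ht : t ∈ Ioc (0 : ℝ) 1) (x : M) :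
    (heatKernel φ ℓ t x x).re ≤ κ₂ * t ^ (-α / 2) := by
  have := (Complex.re_le_norm _).trans (h.upper t ht x x)
  simpa using this

/-- Multiplying the coefficients of the heat kernel by a bounded sequence. -/
theorem norm_tsum_le (h : GaussianBounds α κ₂ κ₃ κ₄ φ ℓ) (ht : t ∈ Ioc (0 : ℝ) 1) (x y : M)
    {r : ℕ → ℝ} {δ : ℝ} (hr : ∀ k, |r k| ≤ δ) :
    Summable (fun k => ((Real.exp (-(ℓ k) ^ 2 * t) * r k : ℝ) : ℂ) * (φ k x * conj (φ k y))) ∧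
    ‖∑' k, ((Real.exp (-(ℓ k) ^ 2 * t) * r k : ℝ) : ℂ) * (φ k x * conj (φ k y))‖ ≤
      δ * (κ₂ * t ^ (-α / 2)) := by
  have hδ : 0 ≤ δ := (abs_nonneg _).trans (hr 0)
  have hs := (((h.hasSum_diag ht x).add (h.hasSum_diag ht y)).mul_left (δ / 2))
  have hb : ∀ k, ‖((Real.exp (-(ℓ k) ^ 2 * t) * r k : ℝ) : ℂ) * (φ k x * conj (φ k y))‖ ≤
      δ / 2 * (Real.exp (-(ℓ k) ^ 2 * t) * ‖φ k x‖ ^ 2 +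
        Real.exp (-(ℓ k) ^ 2 * t) * ‖φ k y‖ ^ 2) := by
    intro k
    rw [norm_mul, norm_mul, RCLike.norm_conj, Complex.norm_real, Real.norm_eq_abs, abs_mul,
      abs_of_pos (Real.exp_pos _)]
    -- This dominates the off-diagonal series by the average of two diagonal ones.
    have h1 : ‖φ k x‖ * ‖φ k y‖ ≤ (‖φ k x‖ ^ 2 + ‖φ k y‖ ^ 2) / 2 := by
      nlinarith [sq_nonneg (‖φ k x‖ - ‖φ k y‖)]
    calc _ ≤ Real.exp (-(ℓ k) ^ 2 * t) * δ * ((‖φ k x‖ ^ 2 + ‖φ k y‖ ^ 2) / 2) := by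
          gcongr
          exact hr k
      _ = _ := by ring
  refine ⟨Summable.of_norm_bounded hs.summable hb, (tsum_of_norm_bounded hs hb).trans ?_⟩
  have h1 := h.diag_le ht x
  have h2 := h.diag_le ht y
  nlinarith

end GaussianBounds

theorem one_div_sq_rpow {L : ℝ} (hL : 0 < L) (α : ℝ) : (1 / L ^ 2) ^ (-α / 2) = L ^ α := by
  rw [one_div, ← Real.rpow_natCast, ← Real.rpow_neg hL.le, ← Real.rpow_mul hL.le]
  congr 1
  push_cast
  ring

/-- The estimate of the localized kernel by a polynomial approximation of degree `n`. -/
theorem norm_cutoffKernel_le_of_approx [MetricSpace M] {α κ₂ κ₃ κ₄ L C δ : ℝ} (hα : 0 < α)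
    (hκ₂ : 0 < κ₂) (hκ₃ : 0 < κ₃)
    (h : GaussianBounds α κ₂ κ₃ κ₄ φ ℓ) (hL : 1 ≤ L) {n : ℕ} (hn : ((n : ℝ) + 1) / L ^ 2 ≤ 1)
    {q : ℝ → ℝ} (hq : IsPolyBound n C q) (hqg : ∀ v ∈ Icc (0 : ℝ) 1, |cutoffQuotient v - q v| ≤ δ)
    (x y : M) :
    ‖cutoffKernel φ ℓ L x y‖ ≤
      C * (κ₂ * L ^ α * Real.exp (-κ₃ * (L * dist x y) ^ 2 / (n + 1))) + δ * (κ₂ * L ^ α) := by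
  have hL0 : 0 < L := by linarith
  set t : ℝ := 1 / L ^ 2 with ht
  have ht0 : 0 < t := by positivity
  have htmem : ∀ j ≤ n, ((j : ℝ) + 1) * t ∈ Ioc (0 : ℝ) 1 := by
    intro j hj
    refine ⟨by positivity, le_trans ?_ hn⟩
    rw [ht, mul_one_div]
    gcongr
  have ht1 : t ∈ Ioc (0 : ℝ) 1 := by simpa using htmem 0 (Nat.zero_le n)
  obtain ⟨b, hb, hbC⟩ := hq
  set E : ℕ → ℝ := fun k => Real.exp (-(ℓ k) ^ 2 * t) with hE
  have hE1 : ∀ k, E k ∈ Icc (0 : ℝ) 1 := fun k =>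
    ⟨(Real.exp_pos _).le, Real.exp_le_one_iff.mpr (by nlinarith [sq_nonneg (ℓ k)])⟩
  obtain ⟨hs1, hn1⟩ := h.norm_tsum_le ht1 x y (r := fun k => cutoffQuotient (E k) - q (E k))
    (fun k => hqg _ (hE1 k))
  -- The extra factor v in v g(v) shifts the monomial v^j to time (j+1)t, so that even the constant
  -- term yields a heat kernel at positive time.
  have hEpow : ∀ (j k : ℕ), Real.exp (-(ℓ k) ^ 2 * ((j + 1) * t)) = E k * E k ^ j := by
    intro j k
    rw [hE, ← pow_succ', ← Real.exp_nat_mul]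
    congr 1
    push_cast
    ring
  have hs2 : ∀ j ∈ Finset.range (n + 1), Summable fun k => (b j : ℂ) *
      ((Real.exp (-(ℓ k) ^ 2 * ((j + 1) * t)) : ℂ) * (φ k x * conj (φ k y))) := by
    intro j hj
    exact (h.summable _ (htmem j (by simpa [Nat.lt_succ_iff] using hj)) x y).mul_left _
  have hsplit : cutoffKernel φ ℓ L x y =
      ∑ j ∈ Finset.range (n + 1), (b j : ℂ) * heatKernel φ ℓ ((j + 1) * t) x y +
      ∑' k, ((E k * (cutoffQuotient (E k) - q (E k)) : ℝ) : ℂ) * (φ k x * conj (φ k y)) := by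
    simp only [heatKernel, ← tsum_mul_left]
    rw [← Summable.tsum_finsetSum hs2, ← Summable.tsum_add (summable_sum hs2) hs1, cutoffKernel]
    refine tsum_congr fun k => ?_
    have e1 : Real.exp (-(ℓ k / L) ^ 2) = E k := by
      simp only [hE, ht]
      congr 1
      field_simp
    have key : E k * cutoffQuotient (E k) = ∑ j ∈ Finset.range (n + 1), b j * (E k * E k ^ j) +
        E k * (cutoffQuotient (E k) - q (E k)) := by
      rw [mul_sub, hb, Finset.mul_sum, ← add_sub_assoc, eq_sub_iff_add_eq, add_comm]
      congr 1
      exact Finset.sum_congr rfl fun j _ => by ring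
    rw [spectralCutoff, e1, key, Complex.ofReal_add, Complex.ofReal_sum, add_mul, Finset.sum_mul]
    simp only [hEpow, Complex.ofReal_mul, mul_assoc]
    rfl
  have htα : t ^ (-α / 2) = L ^ α := one_div_sq_rpow hL0 α
  rw [hsplit]
  refine (norm_add_le _ _).trans (add_le_add ?_ (by rw [← htα]; exact hn1))
  refine (norm_sum_le _ _).trans ?_
  refine le_trans ?_ (mul_le_mul_of_nonneg_right hbC (by positivity))
  rw [Finset.sum_mul]
  refine Finset.sum_le_sum fun j hj => ?_
  have hjn : j ≤ n := by simpa [Nat.lt_succ_iff] using hj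
  rw [norm_mul, Complex.norm_real, Real.norm_eq_abs]
  refine mul_le_mul_of_nonneg_left ((h.upper _ (htmem j hjn) x y).trans ?_) (abs_nonneg _)
  have h1 : (((j : ℝ) + 1) * t) ^ (-α / 2) ≤ L ^ α := by
    rw [← htα]
    refine Real.rpow_le_rpow_of_nonpos ht0 ?_ (by linarith)
    have : (0 : ℝ) ≤ j := Nat.cast_nonneg j
    nlinarith
  have h2 : -κ₃ * dist x y ^ 2 / ((j + 1) * t) ≤ -κ₃ * (L * dist x y) ^ 2 / (n + 1) := by
    have e : -κ₃ * dist x y ^ 2 / ((j + 1) * t) = -(κ₃ * (L * dist x y) ^ 2 / (j + 1)) := by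
      rw [ht]
      field_simp
    rw [e, neg_mul, neg_div, neg_le_neg_iff]
    gcongr
  gcongr

/-- The kernel is localized: it decays faster than any given power of `L * dist x y`. -/
theorem exists_norm_cutoffKernel_le [MetricSpace M] {α κ₂ κ₃ : ℝ} (hα : 0 < α)
    (hκ₂ : 0 < κ₂) (hκ₃ : 0 < κ₃) (κ₄ : ℝ) {D : ℝ} (hD : ∀ x y : M, dist x y ≤ D) (S : ℕ) :
    ∃ C : ℝ, 0 < C ∧ ∃ L₀ : ℝ, 1 ≤ L₀ ∧ ∀ (φ : ℕ → M → ℂ) (ℓ : ℕ → ℝ),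
      GaussianBounds α κ₂ κ₃ κ₄ φ ℓ → ∀ L : ℝ, L₀ ≤ L → ∀ x y : M,
        ‖cutoffKernel φ ℓ L x y‖ ≤ C * L ^ α / (1 + L * dist x y) ^ S := by
  obtain ⟨C, hC, hq⟩ := exists_isPolyBound_approx contDiff_cutoffQuotient S
  -- With n + 1 ≤ aR, a ≤ 1 keeps the times below 1, because R ≤ L·D ≤ L². And 3a ≤ κ₃ makes the
  -- Gaussian exponent at least 3R, of which 2R pays for 7^n ≤ exp(2R).
  set a : ℝ := min 1 (κ₃ / 3) with ha
  have ha0 : 0 < a := lt_min one_pos (by positivity)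
  have ha1 : a ≤ 1 := min_le_left _ _
  have ha3 : 3 * a ≤ κ₃ := by
    have := min_le_right 1 (κ₃ / 3)
    linarith
  set C₁ : ℝ := (S.factorial : ℝ) * Real.exp 1 with hC₁
  have hC₁0 : 0 < C₁ := by positivity
  have hexp : ∀ R : ℝ, 0 ≤ R → Real.exp (-R) ≤ C₁ / (1 + R) ^ S := by
    intro R hR
    have h1 := Real.pow_div_factorial_le_exp (1 + R) (by linarith) S
    rw [div_le_iff₀ (by positivity), Real.exp_add] at h1
    rw [le_div_iff₀ (by positivity), hC₁]
    calc Real.exp (-R) * (1 + R) ^ S ≤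
        Real.exp (-R) * (Real.exp 1 * Real.exp R * S.factorial) := by gcongr
      _ = (Real.exp (-R) * Real.exp R) * (S.factorial * Real.exp 1) := by ring
      _ = _ := by rw [← Real.exp_add]; simp
  set C₂ : ℝ := (1 + 1 / a) ^ S * 2 with hC₂
  refine ⟨C * κ₂ * (C₁ + (4 / a) ^ S + C₂), by positivity, max 1 D, le_max_left _ _,
    fun φ ℓ h L hL x y => ?_⟩
  have hL1 : 1 ≤ L := (le_max_left _ _).trans hL
  have hLD : D ≤ L := (le_max_right _ _).trans hL
  have hL0 : 0 < L := by linarith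
  have hLα : 0 < L ^ α := Real.rpow_pos_of_pos hL0 α
  set R : ℝ := L * dist x y with hR
  have hR0 : 0 ≤ R := by positivity
  -- For bounded R there is nothing to gain from decay, and a constant approximant suffices.
  -- Otherwise n + 1 = ⌊aR⌋ is positive.
  rcases lt_or_ge (a * R) 1 with hsmall | hbig
  · obtain ⟨q, hq1, hq2⟩ := hq 0
    have h1 := norm_cutoffKernel_le_of_approx hα hκ₂ hκ₃ h hL1 (n := 0)
      (by rw [Nat.cast_zero, zero_add, div_le_one (by positivity)]; exact one_le_pow₀ hL1)
      hq1 hq2 x y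
    have h2 : Real.exp (-κ₃ * R ^ 2 / ((0 : ℕ) + 1)) ≤ 1 := by
      rw [Real.exp_le_one_iff]
      simp only [Nat.cast_zero, zero_add, div_one]
      nlinarith [mul_nonneg hκ₃.le (sq_nonneg R)]
    have h3 : ‖cutoffKernel φ ℓ L x y‖ ≤ C * κ₂ * L ^ α * 2 := by
      refine h1.trans ?_
      simp only [pow_zero, mul_one, Nat.cast_zero, zero_add, one_pow, div_one] at h2 ⊢
      have : C * (κ₂ * L ^ α * Real.exp (-κ₃ * R ^ 2)) ≤ C * (κ₂ * L ^ α * 1) := by gcongr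
      linarith
    rw [le_div_iff₀ (by positivity)]
    have h4 : (1 + R) ^ S ≤ (1 + 1 / a) ^ S := by
      gcongr
      rw [le_div_iff₀ ha0]
      linarith
    calc _ ≤ C * κ₂ * L ^ α * 2 * (1 + 1 / a) ^ S := by gcongr
      _ = C * κ₂ * C₂ * L ^ α := by rw [hC₂]; ring
      _ ≤ _ := by
        gcongr
        have : 0 < (4 / a) ^ S := by positivity
        linarith
  · obtain ⟨n, hn⟩ : ∃ n : ℕ, n + 1 = ⌊a * R⌋₊ :=
      ⟨⌊a * R⌋₊ - 1, Nat.sub_add_cancel (Nat.one_le_iff_ne_zero.mpr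
        (Nat.floor_pos.mpr hbig).ne')⟩
    have hn1 : (n : ℝ) + 1 ≤ a * R := by
      have := Nat.floor_le (by positivity : 0 ≤ a * R)
      rw [← hn] at this
      exact_mod_cast this
    have hn2 : a * R < n + 1 + 1 := by
      have := Nat.lt_floor_add_one (a * R)
      rw [← hn] at this
      exact_mod_cast this
    have hn0 : (0 : ℝ) ≤ n := Nat.cast_nonneg n
    obtain ⟨q, hq1, hq2⟩ := hq n
    have hnt : ((n : ℝ) + 1) / L ^ 2 ≤ 1 := by
      rw [div_le_one (by positivity)]
      calc (n : ℝ) + 1 ≤ a * R := hn1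
        _ ≤ 1 * R := by gcongr
        _ = L * dist x y := one_mul _
        _ ≤ L * L := by gcongr; exact (hD x y).trans hLD
        _ = L ^ 2 := by ring
    have h1 := norm_cutoffKernel_le_of_approx hα hκ₂ hκ₃ h hL1 hnt hq1 hq2 x y
    have h2 : (7 : ℝ) ^ n * Real.exp (-κ₃ * R ^ 2 / (n + 1)) ≤ Real.exp (-R) := by
      have h7 : (7 : ℝ) ≤ Real.exp 2 := by
        have := Real.exp_one_gt_d9
        rw [show (2 : ℝ) = 1 + 1 by norm_num, Real.exp_add]
        nlinarith
      have h7n : (7 : ℝ) ^ n ≤ Real.exp (2 * R) := by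
        calc (7 : ℝ) ^ n ≤ Real.exp 2 ^ n := by gcongr
          _ = Real.exp (n * 2) := (Real.exp_nat_mul _ _).symm
          _ ≤ _ := by
            apply Real.exp_le_exp.mpr
            nlinarith
      calc _ ≤ Real.exp (2 * R) * Real.exp (-κ₃ * R ^ 2 / (n + 1)) := by gcongr
        _ = Real.exp (2 * R + -κ₃ * R ^ 2 / (n + 1)) := (Real.exp_add _ _).symm
        _ ≤ _ := by
          apply Real.exp_le_exp.mpr
          have : 3 * R ≤ κ₃ * R ^ 2 / (n + 1) := by
            rw [le_div_iff₀ (by positivity)]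
            calc 3 * R * (n + 1) ≤ 3 * R * (a * R) := by gcongr
              _ = 3 * a * R ^ 2 := by ring
              _ ≤ _ := by gcongr
          rw [neg_mul, neg_div]
          linarith
    have hRa : 1 ≤ R := by nlinarith
    -- Here 1 + R ≤ 2R < 2(n + 2)/a ≤ 4(n + 1)/a.
    have h3 : 1 / ((n : ℝ) + 1) ^ S ≤ (4 / a) ^ S / (1 + R) ^ S := by
      rw [← div_pow, ← one_div_pow]
      refine pow_le_pow_left₀ (by positivity) ?_ S
      rw [div_div, div_le_div_iff₀ (by positivity) (by positivity)]
      nlinarith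
    calc _ ≤ C * κ₂ * L ^ α * ((7 : ℝ) ^ n * Real.exp (-κ₃ * R ^ 2 / (n + 1))) +
          C * κ₂ * L ^ α * (1 / ((n : ℝ) + 1) ^ S) := by
          refine h1.trans (le_of_eq ?_)
          ring
      _ ≤ C * κ₂ * L ^ α * (C₁ / (1 + R) ^ S) +
          C * κ₂ * L ^ α * ((4 / a) ^ S / (1 + R) ^ S) := by
          gcongr
          exact h2.trans (hexp R hR0)
      _ = C * κ₂ * (C₁ + (4 / a) ^ S) * L ^ α / (1 + R) ^ S := by ring
      _ ≤ _ := by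
          refine div_le_div_of_nonneg_right (mul_le_mul_of_nonneg_right (mul_le_mul_of_nonneg_left
            (le_add_of_nonneg_right ?_) ?_) ?_) ?_ <;> positivity

end Kernel

/-! ## Diffusion polynomials -/

theorem diffusionPoly_mono {M : Type*} {φ : ℕ → M → ℂ} {ℓ : ℕ → ℝ} {L L' : ℝ} (hL : L ≤ L') :
    diffusionPoly φ ℓ L ≤ diffusionPoly φ ℓ L' :=
  Submodule.span_mono (image_mono fun _ hk => le_trans hk hL)

namespace IsDiffusionSystem

variable {M : Type*} [MetricSpace M] [MeasurableSpace M] {μ : Measure M}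
  {φ : ℕ → M → ℂ} {ℓ : ℕ → ℝ} {L : ℝ}

theorem finite_le (h : IsDiffusionSystem μ φ ℓ) (L : ℝ) : {k | ℓ k ≤ L}.Finite := by
  obtain ⟨N, hN⟩ := (h.ell_tendsto.eventually_gt_atTop L).exists_forall_of_atTop
  refine (Set.finite_lt_nat N).subset fun k hk => ?_
  by_contra hkN
  exact absurd (hN k (not_lt.mp hkN)) (not_lt.mpr hk)

/-- The indices of degree at most `L`. -/
noncomputable def degrees (h : IsDiffusionSystem μ φ ℓ) (L : ℝ) : Finset ℕ :=
  (h.finite_le L).toFinset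

@[simp] theorem mem_degrees (h : IsDiffusionSystem μ φ ℓ) {k : ℕ} :
    k ∈ h.degrees L ↔ ℓ k ≤ L := by
  simp [degrees]

theorem one_le_ell (h : IsDiffusionSystem μ φ ℓ) (k : ℕ) : 1 ≤ ℓ k :=
  h.ell_zero ▸ h.ell_mono (Nat.zero_le k)

theorem sum_mem (h : IsDiffusionSystem μ φ ℓ) (a : ℕ → ℂ) :
    (fun x => ∑ k ∈ h.degrees L, a k * φ k x) ∈ diffusionPoly φ ℓ L := by
  have e : (fun x => ∑ k ∈ h.degrees L, a k * φ k x) = ∑ k ∈ h.degrees L, a k • φ k := by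
    funext x
    simp
  rw [e]
  exact Submodule.sum_mem _ fun k hk => Submodule.smul_mem _ _
    (Submodule.subset_span ⟨k, h.mem_degrees.mp hk, rfl⟩)

theorem exists_coeff (h : IsDiffusionSystem μ φ ℓ) {P : M → ℂ} (hP : P ∈ diffusionPoly φ ℓ L) :
    ∃ a : ℕ → ℂ, P = fun x => ∑ k ∈ h.degrees L, a k * φ k x := by
  induction hP using Submodule.span_induction with
  | mem f hf =>
    obtain ⟨k, hk, rfl⟩ := hf
    refine ⟨fun j => if j = k then 1 else 0, funext fun x => ?_⟩
    simp only [ite_mul, one_mul, zero_mul, Finset.sum_ite_eq']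
    rw [if_pos (h.mem_degrees.mpr hk)]
  | zero => exact ⟨0, by funext x; simp⟩
  | add f g _ _ hf hg =>
    obtain ⟨a, rfl⟩ := hf
    obtain ⟨b, rfl⟩ := hg
    refine ⟨a + b, funext fun x => ?_⟩
    simp [add_mul, Finset.sum_add_distrib]
  | smul c f _ hf =>
    obtain ⟨a, rfl⟩ := hf
    refine ⟨fun k => c * a k, funext fun x => ?_⟩
    simp [Finset.mul_sum, mul_assoc]

theorem continuous_sum (h : IsDiffusionSystem μ φ ℓ) (s : Finset ℕ) (a : ℕ → ℂ) :
    Continuous fun x => ∑ k ∈ s, a k * φ k x :=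
  continuous_finsetSum _ fun k _ => continuous_const.mul (h.continuous k)

theorem continuous_of_mem (h : IsDiffusionSystem μ φ ℓ) {P : M → ℂ}
    (hP : P ∈ diffusionPoly φ ℓ L) : Continuous P := by
  obtain ⟨a, rfl⟩ := h.exists_coeff hP
  exact h.continuous_sum _ a

theorem cutoffKernel_eq_sum (h : IsDiffusionSystem μ φ ℓ) (hL : 0 < L) (x y : M) :
    cutoffKernel φ ℓ L x y =
      ∑ k ∈ h.degrees (2 * L), (spectralCutoff (ℓ k / L) : ℂ) * (φ k x * conj (φ k y)) := by
  refine tsum_eq_sum fun k hk => ?_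
  rw [h.mem_degrees, not_le] at hk
  rw [spectralCutoff_eq_zero ((le_div_iff₀ hL).mpr hk.le), Complex.ofReal_zero, zero_mul]

theorem cutoffKernel_conj (h : IsDiffusionSystem μ φ ℓ) (hL : 0 < L) (x y : M) :
    conj (cutoffKernel φ ℓ L x y) = cutoffKernel φ ℓ L y x := by
  rw [h.cutoffKernel_eq_sum hL, h.cutoffKernel_eq_sum hL, map_sum]
  refine Finset.sum_congr rfl fun k _ => ?_
  simp only [map_mul, Complex.conj_ofReal, Complex.conj_conj]
  ring

theorem norm_cutoffKernel_comm (h : IsDiffusionSystem μ φ ℓ) (hL : 0 < L) (x y : M) :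
    ‖cutoffKernel φ ℓ L x y‖ = ‖cutoffKernel φ ℓ L y x‖ := by
  rw [← h.cutoffKernel_conj hL, RCLike.norm_conj]

theorem cutoffKernel_mem (h : IsDiffusionSystem μ φ ℓ) (hL : 0 < L) (y : M) :
    (fun x => cutoffKernel φ ℓ L x y) ∈ diffusionPoly φ ℓ (2 * L) := by
  have e : (fun x => cutoffKernel φ ℓ L x y) = fun x => ∑ k ∈ h.degrees (2 * L),
      ((spectralCutoff (ℓ k / L) : ℂ) * conj (φ k y)) * φ k x := by
    funext x
    rw [h.cutoffKernel_eq_sum hL]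
    exact Finset.sum_congr rfl fun k _ => by ring
  rw [e]
  exact h.sum_mem _

theorem cutoffKernel_mem_right (h : IsDiffusionSystem μ φ ℓ) (hL : 0 < L) (x : M) :
    cutoffKernel φ ℓ L x ∈ diffusionPoly φ ℓ (2 * L) := by
  have e : cutoffKernel φ ℓ L x = fun y => conj (cutoffKernel φ ℓ L y x) :=
    funext fun y => (h.cutoffKernel_conj hL y x).symm
  rw [e]
  exact h.conj_mem _ _ (h.cutoffKernel_mem hL x)

theorem continuous_cutoffKernel (h : IsDiffusionSystem μ φ ℓ) (hL : 0 < L) :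
    Continuous fun p : M × M => cutoffKernel φ ℓ L p.1 p.2 := by
  simp only [h.cutoffKernel_eq_sum hL]
  exact continuous_finsetSum _ fun k _ => continuous_const.mul
    (((h.continuous k).comp continuous_fst).mul
      (Complex.continuous_conj.comp ((h.continuous k).comp continuous_snd)))

/-- At time 1/L² every index with ℓ_k ≤ L carries weight at least 1/e in the diagonal heat kernel.
-/
theorem sum_norm_sq_le {α κ₂ κ₃ κ₄ : ℝ} (h : IsDiffusionSystem μ φ ℓ) (hG : GaussianBounds α κ₂ κ₃ κ₄ φ ℓ)
    (hL : 1 ≤ L) (x : M) :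
    ∑ k ∈ h.degrees L, ‖φ k x‖ ^ 2 ≤ Real.exp 1 * κ₂ * L ^ α := by
  have hL0 : 0 < L := by linarith
  have ht : 1 / L ^ 2 ∈ Ioc (0 : ℝ) 1 :=
    ⟨by positivity, (div_le_one (by positivity)).mpr (one_le_pow₀ hL)⟩
  have h1 := (hG.hasSum_diag ht x).mul_left (Real.exp 1)
  calc ∑ k ∈ h.degrees L, ‖φ k x‖ ^ 2 ≤
      ∑ k ∈ h.degrees L, Real.exp 1 * (Real.exp (-(ℓ k) ^ 2 * (1 / L ^ 2)) * ‖φ k x‖ ^ 2) := by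
        refine Finset.sum_le_sum fun k hk => ?_
        rw [h.mem_degrees] at hk
        rw [← mul_assoc, ← Real.exp_add]
        refine le_mul_of_one_le_left (sq_nonneg _) (Real.one_le_exp ?_)
        have h2 : ℓ k ^ 2 / L ^ 2 ≤ 1 := by
          rw [div_le_one (by positivity)]
          have := h.one_le_ell k
          gcongr
        rw [mul_one_div, neg_div]
        linarith
    _ ≤ Real.exp 1 * (heatKernel φ ℓ (1 / L ^ 2) x x).re :=
        sum_le_hasSum _ (fun k _ => by positivity) h1
    _ ≤ Real.exp 1 * (κ₂ * L ^ α) := by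
        have := hG.diag_le ht x
        rw [one_div_sq_rpow hL0] at this
        gcongr
    _ = _ := by ring

variable [CompactSpace M] [BorelSpace M]

theorem _root_.Continuous.integrable_of_compactSpace {f : M → ℂ} (hf : Continuous f)
    (ν : Measure M) [IsFiniteMeasure ν] : Integrable f ν :=
  hf.integrable_of_hasCompactSupport (HasCompactSupport.of_compactSpace f)

variable [IsProbabilityMeasure μ]

theorem integral_sum_mul_conj (h : IsDiffusionSystem μ φ ℓ) (s : Finset ℕ) (a b : ℕ → ℂ) :
    ∫ x, (∑ k ∈ s, a k * φ k x) * conj (∑ k ∈ s, b k * φ k x) ∂μ = ∑ k ∈ s, a k * conj (b k) := by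
  have hc : ∀ j k, Continuous fun x => a j * conj (b k) * (φ j x * conj (φ k x)) := fun j k =>
    continuous_const.mul ((h.continuous j).mul (Complex.continuous_conj.comp (h.continuous k)))
  have e : ∀ x, (∑ k ∈ s, a k * φ k x) * conj (∑ k ∈ s, b k * φ k x) =
      ∑ j ∈ s, ∑ k ∈ s, a j * conj (b k) * (φ j x * conj (φ k x)) := by
    intro x
    rw [map_sum, Finset.sum_mul_sum]
    refine Finset.sum_congr rfl fun j _ => Finset.sum_congr rfl fun k _ => ?_
    rw [map_mul]
    ring
  simp only [e]
  rw [integral_finsetSum _ fun j _ => integrable_finsetSum _ fun k _ =>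
    (hc j k).integrable_of_compactSpace μ]
  refine Finset.sum_congr rfl fun j hj => ?_
  rw [integral_finsetSum _ fun k _ => (hc j k).integrable_of_compactSpace μ]
  simp only [integral_const_mul, h.orthonormal, mul_ite, mul_one, mul_zero, Finset.sum_ite_eq]
  rw [if_pos hj]

theorem integral_norm_sq_sum (h : IsDiffusionSystem μ φ ℓ) (s : Finset ℕ) (a : ℕ → ℂ) :
    ∫ x, ‖∑ k ∈ s, a k * φ k x‖ ^ 2 ∂μ = ∑ k ∈ s, ‖a k‖ ^ 2 := by
  have := h.integral_sum_mul_conj s a a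
  simp only [Complex.mul_conj, Complex.normSq_eq_norm_sq] at this
  rw [integral_complex_ofReal, ← Complex.ofReal_sum] at this
  exact_mod_cast this

theorem integral_norm_sq_cutoffKernel (h : IsDiffusionSystem μ φ ℓ) (hL : 0 < L) (y : M) :
    ∫ x, ‖cutoffKernel φ ℓ L x y‖ ^ 2 ∂μ =
      ∑ k ∈ h.degrees (2 * L), spectralCutoff (ℓ k / L) ^ 2 * ‖φ k y‖ ^ 2 := by
  have e : ∀ x, cutoffKernel φ ℓ L x y = ∑ k ∈ h.degrees (2 * L),
      ((spectralCutoff (ℓ k / L) : ℂ) * conj (φ k y)) * φ k x := by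
    intro x
    rw [h.cutoffKernel_eq_sum hL]
    exact Finset.sum_congr rfl fun k _ => by ring
  simp only [e]
  rw [h.integral_norm_sq_sum]
  refine Finset.sum_congr rfl fun k _ => ?_
  rw [norm_mul, RCLike.norm_conj, Complex.norm_real, mul_pow, Real.norm_eq_abs, sq_abs]

/-- The localized kernel reproduces the diffusion polynomials of degree at most `L`. -/
theorem reproducing (h : IsDiffusionSystem μ φ ℓ) (hL : 0 < L) {P : M → ℂ}
    (hP : P ∈ diffusionPoly φ ℓ L) (x : M) :
    ∫ y, P y * cutoffKernel φ ℓ L x y ∂μ = P x := by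
  obtain ⟨a, ha⟩ := h.exists_coeff (diffusionPoly_mono (by linarith : L ≤ 2 * L) hP)
  obtain ⟨a', ha'⟩ := h.exists_coeff hP
  -- The cutoff is 1 where ℓ_k ≤ L. Above L, pairing the two expansions of P with φ_k shows that the
  -- coefficient vanishes.
  have hcoef : ∀ k ∈ h.degrees (2 * L), a k * spectralCutoff (ℓ k / L) = a k := by
    intro k hk
    rcases le_or_gt (ℓ k) L with hkL | hkL
    · rw [spectralCutoff_eq_one (div_nonneg (by linarith [h.one_le_ell k]) hL.le)
        ((div_le_one hL).mpr hkL), Complex.ofReal_one, mul_one]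
    · have h1 := h.integral_sum_mul_conj (h.degrees (2 * L)) a (fun j => if j = k then 1 else 0)
      have h2 := h.integral_sum_mul_conj (h.degrees (2 * L))
        (fun j => if j ∈ h.degrees L then a' j else 0) (fun j => if j = k then 1 else 0)
      have e : ∀ x, ∑ j ∈ h.degrees (2 * L), (if j ∈ h.degrees L then a' j else 0) * φ j x =
          ∑ j ∈ h.degrees (2 * L), a j * φ j x := by
        intro x
        rw [← congrFun ha x, congrFun ha' x]
        simp only [ite_mul, zero_mul]
        rw [← Finset.sum_filter]
        congr 1
        ext j
        simp only [Finset.mem_filter, mem_degrees]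
        constructor
        · exact fun hj => hj.2
        · exact fun hj => ⟨by linarith, hj⟩
      simp only [e] at h2
      rw [h1] at h2
      simp only [apply_ite conj, map_one, map_zero, mul_ite, mul_one, mul_zero,
        Finset.sum_ite_eq', if_pos hk] at h2
      rw [if_neg (by simpa using hkL)] at h2
      rw [h2, zero_mul]
  have e : ∀ y, P y * cutoffKernel φ ℓ L x y = (∑ k ∈ h.degrees (2 * L), a k * φ k y) *
      conj (∑ k ∈ h.degrees (2 * L), ((spectralCutoff (ℓ k / L) : ℂ) * conj (φ k x)) * φ k y) := by
    intro y
    rw [ha, h.cutoffKernel_eq_sum hL, map_sum]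
    congr 1
    refine Finset.sum_congr rfl fun k _ => ?_
    simp only [map_mul, Complex.conj_ofReal, Complex.conj_conj]
    ring
  simp only [e]
  rw [h.integral_sum_mul_conj, ha]
  refine Finset.sum_congr rfl fun k hk => ?_
  simp only [map_mul, Complex.conj_ofReal, Complex.conj_conj]
  rw [← mul_assoc, hcoef k hk]

section Christoffel

variable {α κ₂ κ₃ κ₄ : ℝ}

/-- Integrate the pointwise bound of `sum_norm_sq_le`: each φ_k has norm 1 and μ has mass 1. -/
theorem card_degrees_le (h : IsDiffusionSystem μ φ ℓ) (hG : GaussianBounds α κ₂ κ₃ κ₄ φ ℓ)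
    (hL : 1 ≤ L) : ((h.degrees L).card : ℝ) ≤ Real.exp 1 * κ₂ * L ^ α := by
  have hn : ∀ k, ∫ x, ‖φ k x‖ ^ 2 ∂μ = 1 := by
    intro k
    have := h.integral_norm_sq_sum {k} (fun _ => 1)
    simpa using this
  have hi : ∀ k, Integrable (fun x => ‖φ k x‖ ^ 2) μ := fun k => by
    have hc : Continuous fun x => ‖φ k x‖ ^ 2 := (h.continuous k).norm.pow 2
    exact hc.integrable_of_hasCompactSupport (HasCompactSupport.of_compactSpace _)
  calc ((h.degrees L).card : ℝ) = ∑ k ∈ h.degrees L, ∫ x, ‖φ k x‖ ^ 2 ∂μ := by simp [hn]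
    _ = ∫ x, ∑ k ∈ h.degrees L, ‖φ k x‖ ^ 2 ∂μ := (integral_finsetSum _ fun k _ => hi k).symm
    _ ≤ ∫ _, Real.exp 1 * κ₂ * L ^ α ∂μ :=
        integral_mono (integrable_finsetSum _ fun k _ => hi k) (integrable_const _)
          fun x => h.sum_norm_sq_le hG hL x
    _ = _ := by simp

end Christoffel

end IsDiffusionSystem

/-- At time t = (B/L)² the indices with ℓ_k > L contribute at most exp(-B²/2) times the heat kernel
at time t/2, since half of the exponent ℓ_k² t already exceeds B²/2. For B large this is at most
half the diagonal lower bound, so the low frequencies must supply the other half. -/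
theorem exists_le_sum_norm_sq {α κ₄ : ℝ} (κ₂ : ℝ) (hκ₄ : 0 < κ₄) (κ₃ : ℝ) (M : Type*)
    [MetricSpace M] [MeasurableSpace M] :
    ∃ c : ℝ, 0 < c ∧ ∃ L₀ : ℝ, 1 ≤ L₀ ∧ ∀ (μ : Measure M) (φ : ℕ → M → ℂ) (ℓ : ℕ → ℝ)
      (h : IsDiffusionSystem μ φ ℓ), GaussianBounds α κ₂ κ₃ κ₄ φ ℓ → ∀ L : ℝ, L₀ ≤ L → ∀ x : M,
        c * L ^ α ≤ ∑ k ∈ h.degrees L, ‖φ k x‖ ^ 2 := by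
  obtain ⟨B, hB1, hB⟩ : ∃ B : ℝ, 1 ≤ B ∧
      Real.exp (-(B ^ 2 / 2)) * (κ₂ * (1 / 2) ^ (-α / 2)) ≤ κ₄ / 2 := by
    have h1 : Tendsto (fun B : ℝ => Real.exp (-(B ^ 2 / 2)) * (κ₂ * (1 / 2) ^ (-α / 2)))
        atTop (𝓝 (0 * (κ₂ * (1 / 2) ^ (-α / 2)))) := by
      refine Tendsto.mul_const _ (Real.tendsto_exp_atBot.comp
        (tendsto_neg_atTop_atBot.comp ?_))
      exact (tendsto_pow_atTop two_ne_zero).atTop_div_const two_pos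
    rw [zero_mul] at h1
    exact ((eventually_ge_atTop 1).and
      (h1.eventually (ge_mem_nhds (by positivity : (0 : ℝ) < κ₄ / 2)))).exists
  have hB0 : 0 < B := by linarith
  refine ⟨κ₄ / 2 * (1 / B) ^ α, by positivity, B, hB1, fun μ φ ℓ h hG L hL x => ?_⟩
  have hL0 : 0 < L := by linarith
  set t : ℝ := 1 / (L / B) ^ 2 with ht
  have ht1 : t ∈ Ioc (0 : ℝ) 1 :=
    ⟨by positivity, (div_le_one (by positivity)).mpr (one_le_pow₀ ((one_le_div hB0).mpr hL))⟩
  have ht2 : t / 2 ∈ Ioc (0 : ℝ) 1 := ⟨by linarith [ht1.1], by linarith [ht1.1, ht1.2]⟩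
  have hpow : t ^ (-α / 2) = L ^ α * (1 / B) ^ α := by
    rw [ht, one_div_sq_rpow (by positivity), ← Real.mul_rpow hL0.le (by positivity), mul_one_div]
  have hpow2 : (t / 2) ^ (-α / 2) = t ^ (-α / 2) * (1 / 2) ^ (-α / 2) := by
    rw [← Real.mul_rpow ht1.1.le (by positivity), mul_one_div]
  have hsum : HasSum (fun k => if k ∈ h.degrees L then ‖φ k x‖ ^ 2 else 0)
      (∑ k ∈ h.degrees L, ‖φ k x‖ ^ 2) := by
    have h1 : ∀ k ∉ h.degrees L, (if k ∈ h.degrees L then ‖φ k x‖ ^ 2 else 0) = 0 :=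
      fun k hk => if_neg hk
    have h2 : HasSum (fun k => if k ∈ h.degrees L then ‖φ k x‖ ^ 2 else 0) _ :=
      hasSum_sum_of_ne_finset_zero h1
    rwa [Finset.sum_congr rfl (fun k hk => if_pos hk)] at h2
  have hpt : ∀ k, Real.exp (-(ℓ k) ^ 2 * t) * ‖φ k x‖ ^ 2 ≤
      (if k ∈ h.degrees L then ‖φ k x‖ ^ 2 else 0) +
        Real.exp (-(B ^ 2 / 2)) * (Real.exp (-(ℓ k) ^ 2 * (t / 2)) * ‖φ k x‖ ^ 2) := by
    intro k
    have hE : Real.exp (-(ℓ k) ^ 2 * t) =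
        Real.exp (-(ℓ k) ^ 2 * (t / 2)) * Real.exp (-(ℓ k) ^ 2 * (t / 2)) := by
      rw [← Real.exp_add]
      congr 1
      ring
    split_ifs with hk
    · have h1 : Real.exp (-(ℓ k) ^ 2 * t) ≤ 1 :=
        Real.exp_le_one_iff.mpr (by nlinarith [mul_nonneg (sq_nonneg (ℓ k)) ht1.1.le])
      have h2 : 0 ≤ Real.exp (-(B ^ 2 / 2)) * (Real.exp (-(ℓ k) ^ 2 * (t / 2)) * ‖φ k x‖ ^ 2) := by
        positivity
      nlinarith [sq_nonneg ‖φ k x‖]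
    · rw [h.mem_degrees, not_le] at hk
      rw [zero_add, hE, mul_assoc]
      gcongr
      have h1 : B ^ 2 ≤ ℓ k ^ 2 * t := by
        have e : ℓ k ^ 2 * t = B ^ 2 * (ℓ k ^ 2 / L ^ 2) := by
          rw [ht]
          field_simp
        rw [e]
        refine le_mul_of_one_le_right (sq_nonneg _) ((one_le_div (by positivity)).mpr ?_)
        gcongr
      linarith
  have hle := hasSum_le hpt (hG.hasSum_diag ht1 x)
    (hsum.add ((hG.hasSum_diag ht2 x).mul_left (Real.exp (-(B ^ 2 / 2)))))
  have h1 := hG.lower t ht1 x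
  have h2 := hG.diag_le ht2 x
  rw [hpow2] at h2
  have h3 : Real.exp (-(B ^ 2 / 2)) * (heatKernel φ ℓ (t / 2) x x).re ≤
      κ₄ / 2 * t ^ (-α / 2) := by
    calc _ ≤ Real.exp (-(B ^ 2 / 2)) * (κ₂ * (t ^ (-α / 2) * (1 / 2) ^ (-α / 2))) := by gcongr
      _ = Real.exp (-(B ^ 2 / 2)) * (κ₂ * (1 / 2) ^ (-α / 2)) * t ^ (-α / 2) := by ring
      _ ≤ _ := by
        have := Real.rpow_nonneg ht1.1.le (-α / 2)
        gcongr
  have h4 : κ₄ / 2 * (1 / B) ^ α * L ^ α = κ₄ / 2 * t ^ (-α / 2) := by rw [hpow]; ring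
  linarith

/-! ## Integrals of localized kernels -/

section Integrals

variable {M : Type*} [MetricSpace M] [MeasurableSpace M] [BorelSpace M]

/-- If balls of radius `r ≥ 1 / L` have measure at most `C₀ r ^ α`, then the integral of
`(1 + L * dist x ·) ^ (-S)` is at most a constant times `L ^ (-α)`. -/
theorem lintegral_one_div_pow_le {ν : Measure M} {α C₀ L : ℝ} (hC₀ : 0 ≤ C₀) {S : ℕ}
    (hS : α + 1 ≤ S) (hL : 0 < L)
    (hν : ∀ (x : M) (r : ℝ), 1 / L ≤ r → ν (Metric.closedBall x r) ≤ ENNReal.ofReal (C₀ * r ^ α))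
    (x : M) :
    ∫⁻ y, ENNReal.ofReal (1 / (1 + L * dist x y) ^ S) ∂ν ≤
      ENNReal.ofReal (2 ^ (S + 1) * C₀ / L ^ α) := by
  -- Dyadic decomposition: for the least j with L·dist ≤ 2^j one has 1 + L·dist ≥ 2^j/2. Only radii
  -- 2^j/L ≥ 1/L occur.
  have hpt : ∀ y, ENNReal.ofReal (1 / (1 + L * dist x y) ^ S) ≤
      ∑' j : ℕ, ENNReal.ofReal (2 ^ S / (2 ^ j) ^ S) *
        (Metric.closedBall x (2 ^ j / L)).indicator 1 y := by
    intro y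
    have hex : ∃ j : ℕ, L * dist x y ≤ 2 ^ j := by
      obtain ⟨j, hj⟩ := pow_unbounded_of_one_lt (L * dist x y) one_lt_two
      exact ⟨j, hj.le⟩
    classical
    set j := Nat.find hex with hj
    have hjle : L * dist x y ≤ 2 ^ j := Nat.find_spec hex
    refine le_trans ?_ (ENNReal.le_tsum j)
    have hmem : y ∈ Metric.closedBall x (2 ^ j / L) := by
      rw [Metric.mem_closedBall, dist_comm, le_div_iff₀ hL]
      linarith
    rw [indicator_of_mem hmem, Pi.one_apply, mul_one]
    apply ENNReal.ofReal_le_ofReal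
    rw [← div_pow, ← one_div_pow]
    have hd : 0 ≤ L * dist x y := by positivity
    refine pow_le_pow_left₀ (by positivity) ?_ S
    rw [div_le_div_iff₀ (by positivity) (by positivity), one_mul]
    rcases Nat.eq_zero_or_pos j with h0 | h0
    · rw [h0, pow_zero]
      linarith
    · have hlt : ¬ L * dist x y ≤ 2 ^ (j - 1) := Nat.find_min hex (by omega)
      have e : (2 : ℝ) ^ j = 2 * 2 ^ (j - 1) := by
        rw [← pow_succ']
        congr 1
        omega
      rw [e]
      linarith
  have hterm : ∀ j : ℕ, ENNReal.ofReal (2 ^ S / (2 ^ j) ^ S) * ν (Metric.closedBall x (2 ^ j / L)) ≤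
      ENNReal.ofReal (2 ^ S * C₀ / L ^ α * (1 / 2) ^ j) := by
    intro j
    have h2j : (1 : ℝ) ≤ 2 ^ j := one_le_pow₀ one_le_two
    have h2j0 : (0 : ℝ) < 2 ^ j := by positivity
    refine (mul_le_mul_right (hν x _ (by gcongr)) _).trans ?_
    rw [← ENNReal.ofReal_mul (by positivity)]
    apply ENNReal.ofReal_le_ofReal
    rw [Real.div_rpow h2j0.le hL.le]
    -- S ≥ α + 1 leaves a spare factor 2^(-j), hence a geometric series.
    have h1 : ((2 : ℝ) ^ j) ^ α * 2 ^ j ≤ (2 ^ j) ^ S := by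
      rw [← Real.rpow_natCast (2 ^ j) S]
      nth_rewrite 2 [← Real.rpow_one ((2 : ℝ) ^ j)]
      rw [← Real.rpow_add h2j0]
      exact Real.rpow_le_rpow_of_exponent_le h2j hS
    have h3 : ((2 : ℝ) ^ j) ^ α / (2 ^ j) ^ S ≤ (1 / 2) ^ j := by
      rw [one_div_pow, div_le_div_iff₀ (by positivity) h2j0, one_mul]
      exact h1
    have hLα : 0 < L ^ α := Real.rpow_pos_of_pos hL α
    calc (2 : ℝ) ^ S / (2 ^ j) ^ S * (C₀ * ((2 ^ j) ^ α / L ^ α)) =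
        2 ^ S * C₀ / L ^ α * ((2 ^ j) ^ α / (2 ^ j) ^ S) := by ring
      _ ≤ _ := by gcongr
  have hm : ∀ j : ℕ, Measurable fun y => ENNReal.ofReal (2 ^ S / (2 ^ j) ^ S) *
      (Metric.closedBall x (2 ^ j / L)).indicator 1 y := fun j =>
    (measurable_one.indicator Metric.isClosed_closedBall.measurableSet).const_mul _
  refine (lintegral_mono hpt).trans ?_
  rw [lintegral_tsum fun j => (hm j).aemeasurable]
  have hone : ∀ j : ℕ, ∫⁻ y, ENNReal.ofReal (2 ^ S / (2 ^ j) ^ S) *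
      (Metric.closedBall x (2 ^ j / L)).indicator 1 y ∂ν =
        ENNReal.ofReal (2 ^ S / (2 ^ j) ^ S) * ν (Metric.closedBall x (2 ^ j / L)) := by
    intro j
    rw [lintegral_const_mul _ (measurable_one.indicator Metric.isClosed_closedBall.measurableSet),
      lintegral_indicator_one Metric.isClosed_closedBall.measurableSet]
  simp only [hone]
  have hLα : 0 < L ^ α := Real.rpow_pos_of_pos hL α
  refine (ENNReal.tsum_le_tsum hterm).trans ?_
  rw [← ENNReal.ofReal_tsum_of_nonneg (fun j => by positivity)
    (summable_geometric_two.mul_left _), tsum_mul_left, tsum_geometric_two]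
  apply ENNReal.ofReal_le_ofReal
  rw [pow_succ]
  apply le_of_eq
  ring

end Integrals

/-- Schur's test. -/
theorem lintegral_rpow_le_of_schur {M : Type*} [MeasurableSpace M] {ν₁ ν₂ : Measure M} [SFinite ν₁] [SFinite ν₂]
    {k : M → M → ℝ≥0∞} (hk : Measurable (Function.uncurry k)) {C : ℝ≥0∞}
    (h₂ : ∀ x, ∫⁻ y, k x y ∂ν₂ ≤ C) (h₁ : ∀ y, ∫⁻ x, k x y ∂ν₁ ≤ C)
    {u : M → ℂ} (hu : Measurable u) {p : ℝ} (hp : 1 ≤ p) :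
    ∫⁻ x, (∫⁻ y, k x y * ‖u y‖ₑ ∂ν₂) ^ p ∂ν₁ ≤ C ^ p * ∫⁻ y, ‖u y‖ₑ ^ p ∂ν₂ := by
  have hp0 : 0 < p := by linarith
  have hpt : ∀ x, (∫⁻ y, k x y * ‖u y‖ₑ ∂ν₂) ^ p ≤
      C ^ (p - 1) * ∫⁻ y, k x y * ‖u y‖ₑ ^ p ∂ν₂ := by
    intro x
    have hkx : Measurable (k x) := hk.comp measurable_prodMk_left
    -- Hölder's inequality for the measure with density `k x`, whose total mass is at most C.
    have h := eLpNorm'_le_eLpNorm'_mul_rpow_measure_univ one_pos hp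
      (hu.aestronglyMeasurable (μ := ν₂.withDensity (k x)))
    simp only [eLpNorm', ENNReal.rpow_one, div_one] at h
    rw [lintegral_withDensity_eq_lintegral_mul _ hkx hu.enorm,
      lintegral_withDensity_eq_lintegral_mul _ hkx (hu.enorm.pow_const p),
      withDensity_apply _ MeasurableSet.univ, setLIntegral_univ] at h
    have h3 := ENNReal.rpow_le_rpow h hp0.le
    rw [ENNReal.mul_rpow_of_nonneg _ _ hp0.le, ← ENNReal.rpow_mul, ← ENNReal.rpow_mul,
      one_div_mul_cancel hp0.ne', ENNReal.rpow_one, sub_mul, one_mul,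
      one_div_mul_cancel hp0.ne'] at h3
    refine h3.trans ?_
    rw [mul_comm]
    exact mul_le_mul' (ENNReal.rpow_le_rpow (h₂ x) (by linarith)) le_rfl
  have hm : Measurable (Function.uncurry fun x y => k x y * ‖u y‖ₑ ^ p) :=
    hk.mul ((hu.enorm.pow_const p).comp measurable_snd)
  have hm' : Measurable fun x => ∫⁻ y, k x y * ‖u y‖ₑ ^ p ∂ν₂ := hm.lintegral_prod_right'
  refine (lintegral_mono hpt).trans ?_
  rw [lintegral_const_mul _ hm', lintegral_lintegral_swap hm.aemeasurable]
  calc C ^ (p - 1) * ∫⁻ y, ∫⁻ x, k x y * ‖u y‖ₑ ^ p ∂ν₁ ∂ν₂ ≤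
      C ^ (p - 1) * ∫⁻ y, C * ‖u y‖ₑ ^ p ∂ν₂ := by
        gcongr with y
        have hky : Measurable fun x => k x y := hk.comp measurable_prodMk_right
        rw [lintegral_mul_const _ hky]
        gcongr
        exact h₁ y
    _ = C ^ p * ∫⁻ y, ‖u y‖ₑ ^ p ∂ν₂ := by
        rw [lintegral_const_mul _ (hu.enorm.pow_const p), ← mul_assoc]
        congr 1
        nth_rewrite 2 [← ENNReal.rpow_one C]
        rw [← ENNReal.rpow_add_of_nonneg _ _ (by linarith) zero_le_one, sub_add_cancel]

/-! ## Quadrature measures -/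

/-- A diffusion system with uniform estimates for its localized kernels. -/
structure LocalizedSystem {M : Type*} [MetricSpace M] [MeasurableSpace M] (μ : Measure M)
    (α C c L₀ : ℝ) (S : ℕ) (φ : ℕ → M → ℂ) (ℓ : ℕ → ℝ) : Prop
    extends IsDiffusionSystem μ φ ℓ where
  alpha_pos : 0 < α
  C_pos : 0 < C
  c_pos : 0 < c
  one_le : 1 ≤ L₀
  le_S : α + 1 ≤ S
  kernel_le : ∀ L : ℝ, L₀ ≤ L → ∀ x y : M,
    ‖cutoffKernel φ ℓ L x y‖ ≤ C * L ^ α / (1 + L * dist x y) ^ S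
  card_le : ∀ L : ℝ, L₀ ≤ L → ((toIsDiffusionSystem.degrees L).card : ℝ) ≤ C * L ^ α
  lower : ∀ L : ℝ, L₀ ≤ L → ∀ y : M, c * L ^ α ≤ ∫ x, ‖cutoffKernel φ ℓ L x y‖ ^ 2 ∂μ

/-- The heat kernel bounds are converted into kernel estimates with constants chosen before φ and ℓ;
the uniformity of the theorem rests on this order of quantifiers. The lower bound keeps only the
frequencies ℓ_k ≤ L, where the cutoff is 1. -/
theorem exists_localizedSystem {M : Type*} [MetricSpace M] [CompactSpace M] [MeasurableSpace M]
    [BorelSpace M] (μ : Measure M) [IsProbabilityMeasure μ] {α κ₂ κ₃ κ₄ : ℝ} (hα : 0 < α)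
    (hκ₂ : 0 < κ₂) (hκ₃ : 0 < κ₃) (hκ₄ : 0 < κ₄) :
    ∃ (C c L₀ : ℝ) (S : ℕ), 0 < C ∧ 0 < c ∧ 1 ≤ L₀ ∧ ∀ (φ : ℕ → M → ℂ) (ℓ : ℕ → ℝ),
      IsDiffusionSystem μ φ ℓ → GaussianBounds α κ₂ κ₃ κ₄ φ ℓ →
        LocalizedSystem μ α C c L₀ S φ ℓ := by
  have hD : ∀ x y : M, dist x y ≤ Metric.diam (univ : Set M) := fun x y =>
    Metric.dist_le_diam_of_mem isCompact_univ.isBounded (mem_univ x) (mem_univ y)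
  set S : ℕ := ⌈α + 1⌉₊
  obtain ⟨C, hC, L₁, hL₁, hker⟩ := exists_norm_cutoffKernel_le hα hκ₂ hκ₃ κ₄ hD S
  obtain ⟨c, hc, L₂, -, hlow⟩ := exists_le_sum_norm_sq (α := α) κ₂ hκ₄ κ₃ M
  refine ⟨C + Real.exp 1 * κ₂, c, max L₁ L₂, S, by positivity, hc, le_max_of_le_left hL₁,
    fun φ ℓ h hG => ?_⟩
  have hpos : ∀ L, max L₁ L₂ ≤ L → 1 ≤ L := fun L hL => hL₁.trans ((le_max_left _ _).trans hL)
  refine { h with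
    alpha_pos := hα, C_pos := by positivity, c_pos := hc, one_le := le_max_of_le_left hL₁
    le_S := Nat.le_ceil _
    kernel_le := fun L hL x y => ?_
    card_le := fun L hL => ?_
    lower := fun L hL y => ?_ }
  · have hL0 : 0 < L := by linarith [hpos L hL]
    refine (hker φ ℓ hG L ((le_max_left _ _).trans hL) x y).trans ?_
    have : 0 < Real.exp 1 * κ₂ := by positivity
    gcongr
    linarith
  · have hL0 : 0 < L := by linarith [hpos L hL]
    refine (h.card_degrees_le hG (hpos L hL)).trans ?_
    gcongr
    linarith
  · have hL0 : 0 < L := by linarith [hpos L hL]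
    rw [h.integral_norm_sq_cutoffKernel hL0]
    refine (hlow μ φ ℓ h hG L ((le_max_right _ _).trans hL) y).trans ?_
    have hsub : h.degrees L ⊆ h.degrees (2 * L) := fun k hk => by
      rw [h.mem_degrees] at hk ⊢
      linarith
    refine le_trans (Finset.sum_le_sum fun k hk => ?_)
      (Finset.sum_le_sum_of_subset_of_nonneg hsub fun k _ _ => by positivity)
    rw [h.mem_degrees] at hk
    rw [spectralCutoff_eq_one (div_nonneg (by linarith [h.one_le_ell k]) hL0.le)
      ((div_le_one hL0).mpr hk), one_pow, one_mul]

/-- Balls of radius at least `1 / L` have measure at most `C₀ * r ^ α`. -/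
def IsRegularMeasure {M : Type*} [MetricSpace M] [MeasurableSpace M] (ν : Measure M)
    (α C₀ L : ℝ) : Prop :=
  ∀ (x : M) (r : ℝ), 1 / L ≤ r → ν (Metric.closedBall x r) ≤ ENNReal.ofReal (C₀ * r ^ α)

theorem BallMeasureBound.isRegularMeasure {M : Type*} [MetricSpace M] [MeasurableSpace M]
    {μ : Measure M} [IsFiniteMeasure μ] {α κ₁ L : ℝ} (hμ : BallMeasureBound μ α κ₁) (hL : 0 < L) :
    IsRegularMeasure μ α κ₁ L := fun x r hr => by
  rw [← ofReal_measureReal]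
  exact ENNReal.ofReal_le_ofReal (hμ x r (lt_of_lt_of_le (by positivity) hr))

theorem IsRegularMeasure.mono {M : Type*} [MetricSpace M] [MeasurableSpace M] {ν : Measure M}
    {α C₀ C₁ L : ℝ} (h : IsRegularMeasure ν α C₀ L) (hL : 0 < L) (hC : C₀ ≤ C₁) :
    IsRegularMeasure ν α C₁ L := fun x r hr => by
  refine (h x r hr).trans (ENNReal.ofReal_le_ofReal ?_)
  have : 0 < r := lt_of_lt_of_le (by positivity) hr
  gcongr

theorem enorm_sq_eq_ofReal (z : ℂ) : ‖z‖ₑ ^ 2 = ENNReal.ofReal (‖z‖ ^ 2) := by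
  rw [← ofReal_norm, ENNReal.ofReal_pow (norm_nonneg _)]

theorem integrable_norm_sq {M : Type*} [MetricSpace M] [CompactSpace M] [MeasurableSpace M]
    [BorelSpace M] {f : M → ℂ} (hf : Continuous f) (ν : Measure M) [IsFiniteMeasure ν] :
    Integrable (fun x => ‖f x‖ ^ 2) ν :=
  (hf.norm.pow 2).integrable_of_hasCompactSupport (HasCompactSupport.of_compactSpace _)

theorem lintegral_enorm_sq {M : Type*} [MetricSpace M] [CompactSpace M] [MeasurableSpace M]
    [BorelSpace M] {f : M → ℂ} (hf : Continuous f) (ν : Measure M) [IsFiniteMeasure ν] :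
    ∫⁻ x, ‖f x‖ₑ ^ 2 ∂ν = ENNReal.ofReal (∫ x, ‖f x‖ ^ 2 ∂ν) := by
  rw [ofReal_integral_eq_lintegral_ofReal (integrable_norm_sq hf ν)
    (Eventually.of_forall fun x => sq_nonneg _)]
  simp only [enorm_sq_eq_ofReal]

/-! ### Mass and concentration of the localized kernel. -/

namespace LocalizedSystem

variable {M : Type*} [MetricSpace M] [MeasurableSpace M]
  {μ : Measure M} {α C c L₀ κ₁ L : ℝ} {S : ℕ} {φ : ℕ → M → ℂ} {ℓ : ℕ → ℝ}

theorem pos (h : LocalizedSystem μ α C c L₀ S φ ℓ) (hL : L₀ ≤ L) : 0 < L := by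
  linarith [h.one_le]

theorem kernel_le_sup (h : LocalizedSystem μ α C c L₀ S φ ℓ) (hL : L₀ ≤ L) (x y : M) :
    ‖cutoffKernel φ ℓ L x y‖ ≤ C * L ^ α := by
  have hL0 := h.pos hL
  have hC := h.C_pos
  refine (h.kernel_le L hL x y).trans (div_le_self (by positivity) (one_le_pow₀ ?_))
  have : 0 ≤ L * dist x y := by positivity
  linarith

theorem continuous_kernel_left (h : LocalizedSystem μ α C c L₀ S φ ℓ) (hL : L₀ ≤ L) (y : M) :
    Continuous fun x => cutoffKernel φ ℓ L x y :=
  (h.continuous_cutoffKernel (h.pos hL)).comp (by fun_prop : Continuous fun x => (x, y))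

theorem continuous_kernel_right (h : LocalizedSystem μ α C c L₀ S φ ℓ) (hL : L₀ ≤ L) (x : M) :
    Continuous (cutoffKernel φ ℓ L x) :=
  (h.continuous_cutoffKernel (h.pos hL)).comp (by fun_prop : Continuous fun y => (x, y))

/-- Certifies the ball dilation N used in `isOpenPosMeasure` and `isRegularMeasure_of_quadrature`;
the summand 1 ensures N ≥ 1. -/
theorem radius_spec (h : LocalizedSystem μ α C c L₀ S φ ℓ) (hκ₁ : 0 < κ₁) :
    C ^ 2 * 2 ^ (S + 1) * κ₁ / (1 + 2 * (C ^ 2 * 2 ^ (S + 1) * κ₁) / c) ≤ c / 2 := by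
  have hC := h.C_pos
  have hc := h.c_pos
  rw [div_le_iff₀ (by positivity)]
  have : c / 2 * (1 + 2 * (C ^ 2 * 2 ^ (S + 1) * κ₁) / c) = c / 2 + C ^ 2 * 2 ^ (S + 1) * κ₁ := by
    field_simp
  linarith

variable [BorelSpace M]

theorem lintegral_kernel_le (h : LocalizedSystem μ α C c L₀ S φ ℓ) (hL : L₀ ≤ L)
    {ν : Measure M} {C₀ : ℝ} (hC₀ : 0 ≤ C₀) (hν : IsRegularMeasure ν α C₀ L) (x : M) :
    ∫⁻ y, ‖cutoffKernel φ ℓ L x y‖ₑ ∂ν ≤ ENNReal.ofReal (C * 2 ^ (S + 1) * C₀) := by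
  have hL0 := h.pos hL
  have hC := h.C_pos
  have hLα : 0 < L ^ α := Real.rpow_pos_of_pos hL0 α
  calc ∫⁻ y, ‖cutoffKernel φ ℓ L x y‖ₑ ∂ν ≤
      ∫⁻ y, ENNReal.ofReal (C * L ^ α) * ENNReal.ofReal (1 / (1 + L * dist x y) ^ S) ∂ν := by
        refine lintegral_mono fun y => ?_
        rw [← ofReal_norm, ← ENNReal.ofReal_mul (by positivity), mul_one_div]
        exact ENNReal.ofReal_le_ofReal (h.kernel_le L hL x y)
    _ = ENNReal.ofReal (C * L ^ α) * ∫⁻ y, ENNReal.ofReal (1 / (1 + L * dist x y) ^ S) ∂ν :=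
        lintegral_const_mul' _ _ ENNReal.ofReal_ne_top
    _ ≤ ENNReal.ofReal (C * L ^ α) * ENNReal.ofReal (2 ^ (S + 1) * C₀ / L ^ α) := by
        gcongr
        exact lintegral_one_div_pow_le hC₀ h.le_S hL0 hν x
    _ = _ := by
        rw [← ENNReal.ofReal_mul (by positivity)]
        congr 1
        field_simp

theorem lintegral_kernel_le_left (h : LocalizedSystem μ α C c L₀ S φ ℓ) (hL : L₀ ≤ L)
    {ν : Measure M} {C₀ : ℝ} (hC₀ : 0 ≤ C₀) (hν : IsRegularMeasure ν α C₀ L) (y : M) :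
    ∫⁻ x, ‖cutoffKernel φ ℓ L x y‖ₑ ∂ν ≤ ENNReal.ofReal (C * 2 ^ (S + 1) * C₀) := by
  refine le_trans (le_of_eq (lintegral_congr fun x => ?_)) (h.lintegral_kernel_le hL hC₀ hν y)
  rw [← ofReal_norm, ← ofReal_norm, h.norm_cutoffKernel_comm (h.pos hL)]

/-- One factor is bounded by its supremum, of order L^α, the other by its integral, of order 1. -/
theorem lintegral_kernel_sq_le (h : LocalizedSystem μ α C c L₀ S φ ℓ) (hL : L₀ ≤ L)
    {ν : Measure M} {C₀ : ℝ} (hC₀ : 0 ≤ C₀) (hν : IsRegularMeasure ν α C₀ L) (x : M) :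
    ∫⁻ y, ‖cutoffKernel φ ℓ L x y‖ₑ ^ 2 ∂ν ≤
      ENNReal.ofReal (C ^ 2 * 2 ^ (S + 1) * C₀ * L ^ α) := by
  have hL0 := h.pos hL
  have hC := h.C_pos
  calc ∫⁻ y, ‖cutoffKernel φ ℓ L x y‖ₑ ^ 2 ∂ν ≤
      ∫⁻ y, ENNReal.ofReal (C * L ^ α) * ‖cutoffKernel φ ℓ L x y‖ₑ ∂ν := by
        refine lintegral_mono fun y => ?_
        rw [sq]
        gcongr
        rw [← ofReal_norm]
        exact ENNReal.ofReal_le_ofReal (h.kernel_le_sup hL x y)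
    _ = ENNReal.ofReal (C * L ^ α) * ∫⁻ y, ‖cutoffKernel φ ℓ L x y‖ₑ ∂ν :=
        lintegral_const_mul' _ _ ENNReal.ofReal_ne_top
    _ ≤ ENNReal.ofReal (C * L ^ α) * ENNReal.ofReal (C * 2 ^ (S + 1) * C₀) := by
        gcongr
        exact h.lintegral_kernel_le hL hC₀ hν x
    _ = _ := by
        rw [← ENNReal.ofReal_mul (by positivity)]
        congr 1
        ring

variable [CompactSpace M] [IsProbabilityMeasure μ]

/-- A fixed proportion of the `L²` norm of the localized kernel comes from a ball of radius
comparable with `1 / L`. -/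
theorem le_setLIntegral_kernel_sq (h : LocalizedSystem μ α C c L₀ S φ ℓ)
    (hμ : BallMeasureBound μ α κ₁) (hκ₁ : 0 < κ₁) {N : ℝ} (hN : 1 ≤ N)
    (hNc : C ^ 2 * 2 ^ (S + 1) * κ₁ / N ≤ c / 2) (hL : L₀ ≤ L) (y : M) :
    ENNReal.ofReal (c / 2 * L ^ α) ≤
      ∫⁻ z in Metric.closedBall y (N / L), ‖cutoffKernel φ ℓ L z y‖ₑ ^ 2 ∂μ := by
  have hL0 := h.pos hL
  have hC := h.C_pos
  have hc := h.c_pos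
  have hLα : 0 < L ^ α := Real.rpow_pos_of_pos hL0 α
  have hball : MeasurableSet (Metric.closedBall y (N / L)) :=
    Metric.isClosed_closedBall.measurableSet
  have htotal : ENNReal.ofReal (c * L ^ α) ≤ ∫⁻ z, ‖cutoffKernel φ ℓ L z y‖ₑ ^ 2 ∂μ := by
    rw [lintegral_enorm_sq (h.continuous_kernel_left hL y)]
    exact ENNReal.ofReal_le_ofReal (h.lower L hL y)
  -- Outside the ball one of the two decay factors is at most 1/N, while the other is integrated.
  have hout : ∫⁻ z in (Metric.closedBall y (N / L))ᶜ, ‖cutoffKernel φ ℓ L z y‖ₑ ^ 2 ∂μ ≤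
      ENNReal.ofReal (c / 2 * L ^ α) := by
    calc _ ≤ ∫⁻ z in (Metric.closedBall y (N / L))ᶜ, ENNReal.ofReal ((C * L ^ α) ^ 2 / N) *
          ENNReal.ofReal (1 / (1 + L * dist y z) ^ S) ∂μ := by
          refine setLIntegral_mono' hball.compl fun z hz => ?_
          rw [mem_compl_iff, Metric.mem_closedBall, not_le, div_lt_iff₀ hL0] at hz
          rw [enorm_sq_eq_ofReal, ← ENNReal.ofReal_mul (by positivity)]
          apply ENNReal.ofReal_le_ofReal
          have h1 := h.kernel_le L hL z y
          have hR : N ≤ (1 + L * dist y z) ^ S := by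
            have hS : S ≠ 0 := by
              rintro rfl
              have := h.le_S
              have := h.alpha_pos
              push_cast at *
              linarith
            rw [dist_comm]
            refine le_trans (by linarith) (le_self_pow₀ (by linarith : 1 ≤ 1 + L * dist z y) hS)
          rw [dist_comm z y] at h1
          have hR0 : 0 < (1 + L * dist y z) ^ S := by linarith
          calc _ ≤ (C * L ^ α / (1 + L * dist y z) ^ S) ^ 2 := by gcongr
            _ = (C * L ^ α) ^ 2 / (1 + L * dist y z) ^ S * (1 / (1 + L * dist y z) ^ S) := by
              ring
            _ ≤ _ := by gcongr
      _ ≤ ∫⁻ z, ENNReal.ofReal ((C * L ^ α) ^ 2 / N) *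
          ENNReal.ofReal (1 / (1 + L * dist y z) ^ S) ∂μ := setLIntegral_le_lintegral _ _
      _ = ENNReal.ofReal ((C * L ^ α) ^ 2 / N) *
          ∫⁻ z, ENNReal.ofReal (1 / (1 + L * dist y z) ^ S) ∂μ :=
          lintegral_const_mul' _ _ ENNReal.ofReal_ne_top
      _ ≤ ENNReal.ofReal ((C * L ^ α) ^ 2 / N) *
          ENNReal.ofReal (2 ^ (S + 1) * κ₁ / L ^ α) := by
          gcongr
          exact lintegral_one_div_pow_le hκ₁.le h.le_S hL0 (hμ.isRegularMeasure hL0) y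
      _ ≤ _ := by
          rw [← ENNReal.ofReal_mul (by positivity)]
          apply ENNReal.ofReal_le_ofReal
          calc _ = C ^ 2 * 2 ^ (S + 1) * κ₁ / N * L ^ α := by field_simp
            _ ≤ _ := by gcongr
  rw [← lintegral_add_compl _ hball] at htotal
  have h2 := htotal.trans (add_le_add le_rfl hout)
  rw [show c * L ^ α = c / 2 * L ^ α + c / 2 * L ^ α by ring,
    ENNReal.ofReal_add (by positivity) (by positivity)] at h2
  exact (ENNReal.add_le_add_iff_right ENNReal.ofReal_ne_top).mp h2

/-- For large L the ball holding a positive share of the kernel's energy fits into any given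
neighbourhood. Full support turns the essential suprema in ε_L into pointwise bounds, as needed
because τ may charge μ-null sets. -/
theorem isOpenPosMeasure (h : LocalizedSystem μ α C c L₀ S φ ℓ)
    (hμ : BallMeasureBound μ α κ₁) (hκ₁ : 0 < κ₁) : μ.IsOpenPosMeasure := by
  have hC := h.C_pos
  have hc := h.c_pos
  refine ⟨fun U hU ⟨y, hy⟩ h0 => ?_⟩
  obtain ⟨r, hr, hball⟩ := Metric.nhds_basis_closedBall.mem_iff.mp (hU.mem_nhds hy)
  set N := 1 + 2 * (C ^ 2 * 2 ^ (S + 1) * κ₁) / c with hN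
  have hN1 : 1 ≤ N := by
    rw [hN]
    exact le_add_of_nonneg_right (by positivity)
  set L := max L₀ (N / r) with hL
  have hLL : L₀ ≤ L := le_max_left _ _
  have hL0 := h.pos hLL
  have hr' : N / L ≤ r := by
    rw [div_le_iff₀ hL0]
    have := (div_le_iff₀ hr).mp (le_max_right L₀ (N / r))
    linarith
  have h1 := h.le_setLIntegral_kernel_sq hμ hκ₁ hN1 (h.radius_spec hκ₁) hLL y
  rw [setLIntegral_measure_zero _ _
    (measure_mono_null ((Metric.closedBall_subset_closedBall hr').trans hball) h0)] at h1
  have : 0 < c / 2 * L ^ α := by positivity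
  exact absurd h1 (not_le.mpr (ENNReal.ofReal_pos.mpr this))

end LocalizedSystem

/-! ### Quadrature of products of diffusion polynomials. -/

namespace IsDiffusionSystem

variable {M : Type*} [MetricSpace M] [MeasurableSpace M] {μ τ : Measure M}
  {φ : ℕ → M → ℂ} {ℓ : ℕ → ℝ} {L A ε : ℝ}

/-- A continuous function is bounded everywhere by its essential supremum if the measure has full
support. -/
theorem _root_.Continuous.norm_le_of_eLpNorm_top_lt [OpensMeasurableSpace M]
    [μ.IsOpenPosMeasure] {f : M → ℂ}
    (hf : Continuous f) (hε : eLpNorm f ∞ μ < ENNReal.ofReal ε) (x : M) : ‖f x‖ ≤ ε := by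
  have hε0 : 0 < ε := ENNReal.ofReal_pos.mp (lt_of_le_of_lt zero_le hε)
  have hopen : IsOpen {x | ε < ‖f x‖} := isOpen_lt continuous_const hf.norm
  have hae : ∀ᵐ x ∂μ, ‖f x‖ ≤ ε := by
    rw [eLpNorm_exponent_top] at hε
    filter_upwards [ae_lt_of_essSup_lt hε] with x hx
    rw [← ofReal_norm] at hx
    exact ((ENNReal.ofReal_lt_ofReal_iff hε0).mp hx).le
  have h0 : μ {x | ε < ‖f x‖} = 0 := by
    rw [ae_iff] at hae
    simpa only [not_le] using hae
  have hempty := (hopen.measure_eq_zero_iff μ).mp h0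
  by_contra hx
  have : x ∈ {x | ε < ‖f x‖} := not_le.mp hx
  rw [hempty] at this
  exact this

theorem isProbabilityMeasure_of_quadrature [IsProbabilityMeasure μ] [IsFiniteMeasure τ]
    (h : IsDiffusionSystem μ φ ℓ) (hL : 1 ≤ L) (hτ : IsQuadratureMeasure μ φ ℓ L τ) :
    IsProbabilityMeasure τ := by
  have hmem : φ 0 ∈ diffusionPoly φ ℓ L :=
    Submodule.subset_span ⟨0, by rw [mem_ofPred_eq, h.ell_zero]; exact hL, rfl⟩
  have h1 := hτ _ hmem
  simp only [h.phi_zero, integral_const, probReal_univ, one_smul] at h1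
  have h2 : τ.real univ = 1 := by
    simp only [Complex.real_smul, mul_one] at h1
    exact_mod_cast h1.symm
  refine ⟨?_⟩
  rw [← ofReal_measureReal, h2, ENNReal.ofReal_one]

variable [CompactSpace M] [BorelSpace M] [IsProbabilityMeasure μ] [IsProbabilityMeasure τ]

/-- Replace the product by an approximant from Π_{2AL}, on which the two integrals agree; this costs
ε once for each probability measure. -/
theorem norm_integral_mul_sub_le_basis [μ.IsOpenPosMeasure] (h : IsDiffusionSystem μ φ ℓ)
    (hτ : IsQuadratureMeasure μ φ ℓ (2 * A * L) τ)
    (hε : productError μ φ ℓ A (2 * L) < ENNReal.ofReal ε) {j k : ℕ}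
    (hj : j ∈ h.degrees (2 * L)) (hk : k ∈ h.degrees (2 * L)) :
    ‖∫ x, φ j x * φ k x ∂μ - ∫ x, φ j x * φ k x ∂τ‖ ≤ 2 * ε := by
  have hd : lpDist μ ∞ (φ j * φ k) (diffusionPoly φ ℓ (A * (2 * L))) < ENNReal.ofReal ε := by
    refine lt_of_le_of_lt ?_ hε
    exact le_iSup_of_le j (le_iSup_of_le k (le_iSup_of_le (h.mem_degrees.mp hj)
      (le_iSup_of_le (h.mem_degrees.mp hk) le_rfl)))
  simp only [lpDist, iInf_lt_iff] at hd
  obtain ⟨R, hR, hlt⟩ := hd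
  have hRc := h.continuous_of_mem hR
  have hc : Continuous (φ j * φ k) := (h.continuous j).mul (h.continuous k)
  have hbd := (hc.sub hRc).norm_le_of_eLpNorm_top_lt hlt
  rw [show A * (2 * L) = 2 * A * L by ring] at hR
  have hRint := hτ R hR
  have hb : ∀ (ν : Measure M) [IsProbabilityMeasure ν],
      ‖∫ x, φ j x * φ k x ∂ν - ∫ x, R x ∂ν‖ ≤ ε := by
    intro ν _
    have e := integral_sub (hc.integrable_of_compactSpace ν) (hRc.integrable_of_compactSpace ν)
    simp only [Pi.mul_apply] at e
    rw [← e]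
    have := norm_integral_le_of_norm_le_const (μ := ν) (Eventually.of_forall hbd)
    simpa using this
  have h1 := hb μ
  have h2 := hb τ
  rw [← hRint] at h2
  calc _ = ‖(∫ x, φ j x * φ k x ∂μ - ∫ x, R x ∂μ) - (∫ x, φ j x * φ k x ∂τ - ∫ x, R x ∂μ)‖ := by
        congr 1
        ring
    _ ≤ _ := (norm_sub_le _ _).trans (by linarith)

/-- A quadrature measure nearly integrates products exactly. -/
theorem norm_integral_mul_sub_le [μ.IsOpenPosMeasure] (h : IsDiffusionSystem μ φ ℓ)
    (hτ : IsQuadratureMeasure μ φ ℓ (2 * A * L) τ)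
    (hε : productError μ φ ℓ A (2 * L) < ENNReal.ofReal ε) {P Q : M → ℂ}
    (hP : P ∈ diffusionPoly φ ℓ (2 * L)) (hQ : Q ∈ diffusionPoly φ ℓ (2 * L)) :
    ‖∫ x, P x * Q x ∂μ - ∫ x, P x * Q x ∂τ‖ ≤ 2 * ε * (h.degrees (2 * L)).card *
      (Real.sqrt (∫ x, ‖P x‖ ^ 2 ∂μ) * Real.sqrt (∫ x, ‖Q x‖ ^ 2 ∂μ)) := by
  have hε0 : 0 < ε := ENNReal.ofReal_pos.mp (lt_of_le_of_lt zero_le hε)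
  obtain ⟨a, rfl⟩ := h.exists_coeff hP
  obtain ⟨b, rfl⟩ := h.exists_coeff hQ
  set s := h.degrees (2 * L) with hs
  have hc : ∀ j k, Continuous fun x => a j * b k * (φ j x * φ k x) := fun j k =>
    continuous_const.mul ((h.continuous j).mul (h.continuous k))
  have hexp : ∀ (ν : Measure M) [IsProbabilityMeasure ν],
      ∫ x, (∑ j ∈ s, a j * φ j x) * (∑ k ∈ s, b k * φ k x) ∂ν =
        ∑ j ∈ s, ∑ k ∈ s, a j * b k * ∫ x, φ j x * φ k x ∂ν := by
    intro ν _
    have e : ∀ x, (∑ j ∈ s, a j * φ j x) * (∑ k ∈ s, b k * φ k x) =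
        ∑ j ∈ s, ∑ k ∈ s, a j * b k * (φ j x * φ k x) := by
      intro x
      rw [Finset.sum_mul_sum]
      exact Finset.sum_congr rfl fun j _ => Finset.sum_congr rfl fun k _ => by ring
    simp only [e]
    rw [integral_finsetSum _ fun j _ => integrable_finsetSum _ fun k _ =>
      (hc j k).integrable_of_compactSpace ν]
    refine Finset.sum_congr rfl fun j _ => ?_
    rw [integral_finsetSum _ fun k _ => (hc j k).integrable_of_compactSpace ν]
    exact Finset.sum_congr rfl fun k _ => integral_const_mul _ _
  -- Cauchy–Schwarz costs the square root of the dimension for each factor, hence the dimension in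
  -- total.
  have hl1 : ∀ f : ℕ → ℂ, ∑ k ∈ s, ‖f k‖ ≤ Real.sqrt s.card * Real.sqrt (∑ k ∈ s, ‖f k‖ ^ 2) := by
    intro f
    rw [← Real.sqrt_mul (Nat.cast_nonneg _)]
    exact Real.le_sqrt_of_sq_le sq_sum_le_card_mul_sum_sq
  rw [h.integral_norm_sq_sum, h.integral_norm_sq_sum, hexp μ, hexp τ, ← Finset.sum_sub_distrib]
  simp only [← Finset.sum_sub_distrib, ← mul_sub]
  calc _ ≤ ∑ j ∈ s, ∑ k ∈ s, ‖a j‖ * ‖b k‖ * (2 * ε) := by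
        refine (norm_sum_le _ _).trans (Finset.sum_le_sum fun j hj => (norm_sum_le _ _).trans
          (Finset.sum_le_sum fun k hk => ?_))
        rw [norm_mul, norm_mul]
        gcongr
        exact h.norm_integral_mul_sub_le_basis hτ hε hj hk
    _ = (∑ j ∈ s, ‖a j‖) * (∑ k ∈ s, ‖b k‖) * (2 * ε) := by
        rw [Finset.sum_mul_sum]
        simp only [Finset.sum_mul]
    _ ≤ (Real.sqrt s.card * Real.sqrt (∑ k ∈ s, ‖a k‖ ^ 2)) *
          (Real.sqrt s.card * Real.sqrt (∑ k ∈ s, ‖b k‖ ^ 2)) * (2 * ε) := by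
        gcongr
        · exact hl1 a
        · exact hl1 b
    _ = 2 * ε * (Real.sqrt s.card * Real.sqrt s.card) *
          (Real.sqrt (∑ k ∈ s, ‖a k‖ ^ 2) * Real.sqrt (∑ k ∈ s, ‖b k‖ ^ 2)) := by ring
    _ = _ := by rw [Real.mul_self_sqrt (Nat.cast_nonneg _)]

/-- Take Q = conj P, available since the spaces are closed under conjugation; the error is then at
most the integral itself. -/
theorem integral_norm_sq_quadrature_le [μ.IsOpenPosMeasure] (h : IsDiffusionSystem μ φ ℓ)
    (hτ : IsQuadratureMeasure μ φ ℓ (2 * A * L) τ)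
    (hε : productError μ φ ℓ A (2 * L) < ENNReal.ofReal ε)
    (hcard : 2 * ε * (h.degrees (2 * L)).card ≤ 1) {P : M → ℂ}
    (hP : P ∈ diffusionPoly φ ℓ (2 * L)) :
    ∫ x, ‖P x‖ ^ 2 ∂τ ≤ 2 * ∫ x, ‖P x‖ ^ 2 ∂μ := by
  have h1 := h.norm_integral_mul_sub_le hτ hε hP (h.conj_mem _ P hP)
  simp only [RCLike.norm_conj, Complex.mul_conj, Complex.normSq_eq_norm_sq] at h1
  rw [integral_complex_ofReal, integral_complex_ofReal, ← Complex.ofReal_sub, Complex.norm_real,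
    Real.mul_self_sqrt (integral_nonneg fun x => sq_nonneg _), Real.norm_eq_abs] at h1
  have h0 : 0 ≤ ∫ x, ‖P x‖ ^ 2 ∂μ := integral_nonneg fun x => sq_nonneg _
  have h2 := neg_le_of_abs_le h1
  nlinarith

end IsDiffusionSystem

/-! ### Operator bounds and regularity of quadrature measures. -/

namespace LocalizedSystem

variable {M : Type*} [MetricSpace M] [MeasurableSpace M] [BorelSpace M] [CompactSpace M]
  {μ τ : Measure M} {α C c L₀ κ₁ L A ε : ℝ} {S : ℕ} {φ : ℕ → M → ℂ} {ℓ : ℕ → ℝ}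

/-- The integral operator with the localized kernel is bounded between `L^p` spaces of regular
measures. -/
theorem eLpNorm_integral_kernel_le (h : LocalizedSystem μ α C c L₀ S φ ℓ) (hL : L₀ ≤ L)
    {ν₁ ν₂ : Measure M} [IsFiniteMeasure ν₁] [IsFiniteMeasure ν₂] {C₀ : ℝ} (hC₀ : 0 ≤ C₀)
    (hν₁ : IsRegularMeasure ν₁ α C₀ L) (hν₂ : IsRegularMeasure ν₂ α C₀ L)
    {P : M → ℂ} (hP : Continuous P) {p : ℝ≥0} (hp : 1 ≤ p) :
    eLpNorm (fun x => ∫ y, P y * cutoffKernel φ ℓ L x y ∂ν₂) p ν₁ ≤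
      ENNReal.ofReal (C * 2 ^ (S + 1) * C₀) * eLpNorm P p ν₂ := by
  have hp0 : (p : ℝ≥0∞) ≠ 0 := by
    exact_mod_cast (lt_of_lt_of_le one_pos hp).ne'
  have hpr : (1 : ℝ) ≤ p := by exact_mod_cast hp
  have hpr0 : (0 : ℝ) < p := by linarith
  rw [eLpNorm_eq_lintegral_rpow_enorm_toReal hp0 ENNReal.coe_ne_top,
    eLpNorm_eq_lintegral_rpow_enorm_toReal hp0 ENNReal.coe_ne_top, ENNReal.coe_toReal]
  have hkm : Measurable (Function.uncurry fun x y => ‖cutoffKernel φ ℓ L x y‖ₑ) :=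
    (h.continuous_cutoffKernel (h.pos hL)).measurable.enorm
  have h1 := lintegral_rpow_le_of_schur hkm (h.lintegral_kernel_le hL hC₀ hν₂)
    (h.lintegral_kernel_le_left hL hC₀ hν₁) hP.measurable hpr
  have h2 : ∫⁻ x, ‖∫ y, P y * cutoffKernel φ ℓ L x y ∂ν₂‖ₑ ^ (p : ℝ) ∂ν₁ ≤
      ENNReal.ofReal (C * 2 ^ (S + 1) * C₀) ^ (p : ℝ) * ∫⁻ y, ‖P y‖ₑ ^ (p : ℝ) ∂ν₂ := by
    refine (lintegral_mono fun x => ENNReal.rpow_le_rpow ?_ hpr0.le).trans h1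
    refine (enorm_integral_le_lintegral_enorm _).trans (le_of_eq (lintegral_congr fun y => ?_))
    rw [enorm_mul, mul_comm]
  refine (ENNReal.rpow_le_rpow h2 (by positivity : (0 : ℝ) ≤ 1 / p)).trans (le_of_eq ?_)
  rw [ENNReal.mul_rpow_of_nonneg _ _ (by positivity), ← ENNReal.rpow_mul,
    mul_one_div_cancel hpr0.ne', ENNReal.rpow_one]

variable [IsProbabilityMeasure μ] [IsProbabilityMeasure τ]

/-- The regularity constant of quadrature measures. -/
noncomputable def quadratureConst (α C c L₀ κ₁ : ℝ) (S : ℕ) : ℝ :=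
  4 * κ₁ * (C ^ 2 * 2 ^ (S + 1) * κ₁) / c *
    (1 + (1 + 2 * (C ^ 2 * 2 ^ (S + 1) * κ₁) / c)) ^ α + L₀ ^ α

/-- Quadrature measures are regular at the scale of their order. -/
theorem isRegularMeasure_of_quadrature (h : LocalizedSystem μ α C c L₀ S φ ℓ)
    (hμ : BallMeasureBound μ α κ₁) (hκ₁ : 0 < κ₁) (hLpos : 0 < L)
    (hτ : IsQuadratureMeasure μ φ ℓ (2 * A * L) τ)
    (hε : productError μ φ ℓ A (2 * L) < ENNReal.ofReal ε)
    (hcard : 2 * ε * (h.degrees (2 * L)).card ≤ 1) :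
    IsRegularMeasure τ α (quadratureConst α C c L₀ κ₁ S) L := by
  have := h.isOpenPosMeasure hμ hκ₁
  have hC := h.C_pos
  have hc := h.c_pos
  have hα := h.alpha_pos
  have hL₀ := h.one_le
  set C₂ := C ^ 2 * 2 ^ (S + 1) * κ₁ with hC₂
  have hC₂0 : 0 < C₂ := by positivity
  set N := 1 + 2 * C₂ / c with hN
  have hN1 : 1 ≤ N := by
    rw [hN]
    exact le_add_of_nonneg_right (by positivity)
  intro x r hr
  have hr0 : 0 < r := lt_of_lt_of_le (by positivity) hr
  -- For r > 1/L₀ the total mass 1 is below (L₀ r)^α, whence the summand L₀^α of the constant.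
  -- Otherwise the kernel of level 1/r, between L₀ and L, serves as a test function.
  rcases lt_or_ge (1 / r) L₀ with hbig | hsmall
  · refine prob_le_one.trans ?_
    rw [← ENNReal.ofReal_one]
    apply ENNReal.ofReal_le_ofReal
    have h1 : 1 ≤ L₀ * r := ((div_lt_iff₀ hr0).mp hbig).le
    calc (1 : ℝ) ≤ (L₀ * r) ^ α := Real.one_le_rpow h1 hα.le
      _ = L₀ ^ α * r ^ α := Real.mul_rpow (by linarith) hr0.le
      _ ≤ _ := by
        gcongr
        rw [quadratureConst]
        exact le_add_of_nonneg_left (by positivity)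
  · set L' := 1 / r with hL'
    have hL'0 : 0 < L' := by positivity
    have hL'L : L' ≤ L := by
      rw [hL', div_le_iff₀ hr0]
      rw [div_le_iff₀ hLpos] at hr
      linarith
    have hNL' : N / L' = N * r := by rw [hL']; field_simp
    set B := Metric.closedBall x ((1 + N) * r) with hB
    have hBm : MeasurableSet B := Metric.isClosed_closedBall.measurableSet
    have hkm : Measurable fun p : M × M => ‖cutoffKernel φ ℓ L' p.1 p.2‖ₑ ^ 2 :=
      ((h.continuous_cutoffKernel hL'0).measurable.enorm).pow_const 2
    have hlow : ENNReal.ofReal (c / 2 * L' ^ α) * τ (Metric.closedBall x r) ≤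
        ∫⁻ y, ∫⁻ z in B, ‖cutoffKernel φ ℓ L' z y‖ₑ ^ 2 ∂μ ∂τ := by
      calc _ = ∫⁻ y in Metric.closedBall x r, ENNReal.ofReal (c / 2 * L' ^ α) ∂τ := by
            rw [setLIntegral_const]
        _ ≤ ∫⁻ y in Metric.closedBall x r, ∫⁻ z in B, ‖cutoffKernel φ ℓ L' z y‖ₑ ^ 2 ∂μ ∂τ := by
            refine setLIntegral_mono' Metric.isClosed_closedBall.measurableSet fun y hy => ?_
            refine (h.le_setLIntegral_kernel_sq hμ hκ₁ hN1 (h.radius_spec hκ₁) hsmall y).trans ?_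
            refine lintegral_mono_set ?_
            rw [hNL']
            refine Metric.closedBall_subset_closedBall' ?_
            rw [Metric.mem_closedBall] at hy
            linarith
        _ ≤ _ := setLIntegral_le_lintegral _ _
    -- After the exchange, the inner τ-integral is of the squared modulus of an element of Π_{2L'} ⊆
    -- Π_{2L}, so it is at most twice the μ-integral.
    have hup : ∫⁻ y, ∫⁻ z in B, ‖cutoffKernel φ ℓ L' z y‖ₑ ^ 2 ∂μ ∂τ ≤
        ENNReal.ofReal (2 * (C₂ * L' ^ α)) * ENNReal.ofReal (κ₁ * ((1 + N) * r) ^ α) := by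
      have hkm' : AEMeasurable (Function.uncurry fun y z => ‖cutoffKernel φ ℓ L' z y‖ₑ ^ 2)
          (τ.prod (μ.restrict B)) := (hkm.comp measurable_swap).aemeasurable
      rw [lintegral_lintegral_swap hkm']
      calc _ ≤ ∫⁻ z in B, ENNReal.ofReal (2 * (C₂ * L' ^ α)) ∂μ := by
            refine lintegral_mono fun z => ?_
            have hcz := h.continuous_kernel_right hsmall z
            rw [lintegral_enorm_sq hcz]
            apply ENNReal.ofReal_le_ofReal
            have hmem := diffusionPoly_mono (by linarith : 2 * L' ≤ 2 * L)
              (h.cutoffKernel_mem_right hL'0 z)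
            refine (h.integral_norm_sq_quadrature_le hτ hε hcard hmem).trans ?_
            have h2 := h.lintegral_kernel_sq_le hsmall hκ₁.le (hμ.isRegularMeasure hL'0) z
            rw [lintegral_enorm_sq hcz, ENNReal.ofReal_le_ofReal_iff (by positivity)] at h2
            linarith
        _ = ENNReal.ofReal (2 * (C₂ * L' ^ α)) * μ B := setLIntegral_const _ _
        _ ≤ _ := by
            gcongr
            refine hμ.isRegularMeasure hL'0 x _ ?_
            rw [hL', one_div_one_div]
            nlinarith
    have h3 := hlow.trans hup
    rw [← ofReal_measureReal, ← ENNReal.ofReal_mul (by positivity),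
      ← ENNReal.ofReal_mul (by positivity), ENNReal.ofReal_le_ofReal_iff (by positivity)] at h3
    rw [← ofReal_measureReal]
    apply ENNReal.ofReal_le_ofReal
    have hL'α : 0 < L' ^ α := Real.rpow_pos_of_pos hL'0 α
    rw [Real.mul_rpow (by positivity) hr0.le] at h3
    have h4 : τ.real (Metric.closedBall x r) ≤ 4 * κ₁ * C₂ / c * (1 + N) ^ α * r ^ α := by
      have h5 : (c / 2 * L' ^ α) * τ.real (Metric.closedBall x r) ≤
          (c / 2 * L' ^ α) * (4 * κ₁ * C₂ / c * (1 + N) ^ α * r ^ α) := by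
        refine h3.trans (le_of_eq ?_)
        field_simp
        ring
      exact le_of_mul_le_mul_left h5 (by positivity)
    refine h4.trans ?_
    gcongr
    rw [quadratureConst]
    exact le_add_of_nonneg_right (by positivity)

end LocalizedSystem

/-! ### The Marcinkiewicz–Zygmund inequalities. -/

namespace LocalizedSystem

variable {M : Type*} [MetricSpace M] [MeasurableSpace M] [BorelSpace M] [CompactSpace M]
  {μ τ : Measure M} [IsProbabilityMeasure μ] [IsProbabilityMeasure τ]
  {α C c L₀ κ₁ L A ε : ℝ} {S : ℕ} {φ : ℕ → M → ℂ} {ℓ : ℕ → ℝ}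

/-- A Nikolskii inequality, from the reproducing formula and the supremum of the kernel. It lets the
quadrature error be measured by the L¹ norm, which every L^p(μ) norm dominates. -/
theorem norm_le_integral_norm (h : LocalizedSystem μ α C c L₀ S φ ℓ) (hL : L₀ ≤ L) {P : M → ℂ}
    (hP : P ∈ diffusionPoly φ ℓ L) (x : M) : ‖P x‖ ≤ C * L ^ α * ∫ y, ‖P y‖ ∂μ := by
  have hPc := h.continuous_of_mem hP
  rw [← h.reproducing (h.pos hL) hP x, ← integral_const_mul]
  refine norm_integral_le_of_norm_le
    ((hPc.integrable_of_compactSpace μ).norm.const_mul _) (Eventually.of_forall fun y => ?_)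
  rw [norm_mul, mul_comm]
  gcongr
  exact h.kernel_le_sup hL x y

theorem sqrt_integral_norm_sq_le (h : LocalizedSystem μ α C c L₀ S φ ℓ) (hL : L₀ ≤ L) {P : M → ℂ}
    (hP : P ∈ diffusionPoly φ ℓ L) :
    Real.sqrt (∫ y, ‖P y‖ ^ 2 ∂μ) ≤ C * L ^ α * ∫ y, ‖P y‖ ∂μ := by
  have hC := h.C_pos
  have hL0 := h.pos hL
  have h0 : 0 ≤ ∫ y, ‖P y‖ ∂μ := integral_nonneg fun y => norm_nonneg _
  refine Real.sqrt_le_iff.mpr ⟨by positivity, ?_⟩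
  calc ∫ y, ‖P y‖ ^ 2 ∂μ ≤ ∫ _, (C * L ^ α * ∫ y, ‖P y‖ ∂μ) ^ 2 ∂μ := by
        refine integral_mono (integrable_norm_sq (h.continuous_of_mem hP) μ) (integrable_const _)
          fun y => ?_
        have := h.norm_le_integral_norm hL hP y
        dsimp only
        gcongr
    _ = _ := by simp

/-- The quadrature error in the reproducing formula. -/
theorem norm_sub_integral_kernel_le (h : LocalizedSystem μ α C c L₀ S φ ℓ)
    (hμ : BallMeasureBound μ α κ₁) (hκ₁ : 0 < κ₁) (hL : L₀ ≤ L)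
    (hτ : IsQuadratureMeasure μ φ ℓ (2 * A * L) τ)
    (hε : productError μ φ ℓ A (2 * L) < ENNReal.ofReal ε) {P : M → ℂ}
    (hP : P ∈ diffusionPoly φ ℓ L) (x : M) :
    ‖P x - ∫ y, P y * cutoffKernel φ ℓ L x y ∂τ‖ ≤
      2 * ε * (C * (2 * L) ^ α) * (C * L ^ α * ((1 + C ^ 2 * 2 ^ (S + 1) * κ₁) * L ^ α)) *
        ∫ y, ‖P y‖ ∂μ := by
  have := h.isOpenPosMeasure hμ hκ₁
  have hC := h.C_pos
  have hL0 := h.pos hL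
  have hε0 : 0 < ε := ENNReal.ofReal_pos.mp (lt_of_le_of_lt zero_le hε)
  have h0 : 0 ≤ ∫ y, ‖P y‖ ∂μ := integral_nonneg fun y => norm_nonneg _
  have hLα : 1 ≤ L ^ α := Real.one_le_rpow (h.one_le.trans hL) h.alpha_pos.le
  -- Deliberately crude: powers of L are harmless against the decay of ε.
  have hker : Real.sqrt (∫ y, ‖cutoffKernel φ ℓ L x y‖ ^ 2 ∂μ) ≤
      (1 + C ^ 2 * 2 ^ (S + 1) * κ₁) * L ^ α := by
    have h1 := h.lintegral_kernel_sq_le hL hκ₁.le (hμ.isRegularMeasure hL0) x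
    rw [lintegral_enorm_sq (h.continuous_kernel_right hL x),
      ENNReal.ofReal_le_ofReal_iff (by positivity)] at h1
    set C₂ := C ^ 2 * 2 ^ (S + 1) * κ₁ with hC₂
    have hC₂0 : 0 < C₂ := by positivity
    refine Real.sqrt_le_iff.mpr ⟨by positivity, h1.trans ?_⟩
    have h2 : C₂ ≤ (1 + C₂) ^ 2 := by nlinarith
    have h3 : L ^ α ≤ (L ^ α) ^ 2 := by nlinarith
    rw [mul_pow]
    gcongr
  have h1 := h.norm_integral_mul_sub_le hτ hε
    (diffusionPoly_mono (by linarith : L ≤ 2 * L) hP) (h.cutoffKernel_mem_right hL0 x)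
  rw [h.reproducing hL0 hP x] at h1
  refine h1.trans ?_
  calc _ ≤ 2 * ε * (C * (2 * L) ^ α) * ((C * L ^ α * ∫ y, ‖P y‖ ∂μ) *
        ((1 + C ^ 2 * 2 ^ (S + 1) * κ₁) * L ^ α)) := by
        gcongr
        · exact h.card_le (2 * L) (by linarith)
        · exact h.sqrt_integral_norm_sq_le hL hP
    _ = _ := by ring

/-- The Marcinkiewicz–Zygmund inequalities for quadrature measures. -/
theorem marcinkiewicz_zygmund (h : LocalizedSystem μ α C c L₀ S φ ℓ)
    (hμ : BallMeasureBound μ α κ₁) (hκ₁ : 0 < κ₁) (hL : L₀ ≤ L)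
    (hτ : IsQuadratureMeasure μ φ ℓ (2 * A * L) τ)
    (hε : productError μ φ ℓ A (2 * L) < ENNReal.ofReal ε)
    (hsmall : 2 * ε * (C * (2 * L) ^ α) *
      (1 + C * L ^ α * ((1 + C ^ 2 * 2 ^ (S + 1) * κ₁) * L ^ α)) ≤ 1 / 2)
    {K : ℝ} (hK : K = C * 2 ^ (S + 1) * (κ₁ + quadratureConst α C c L₀ κ₁ S))
    {p : ℝ≥0} (hp : 1 ≤ p) {P : M → ℂ} (hP : P ∈ diffusionPoly φ ℓ L) :
    ENNReal.ofReal (1 / (2 * K)) * eLpNorm P p μ ≤ eLpNorm P p τ ∧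
      eLpNorm P p τ ≤ ENNReal.ofReal K * eLpNorm P p μ := by
  have hC := h.C_pos
  have hc := h.c_pos
  have hL0 := h.pos hL
  have hL₀ := h.one_le
  have hε0 : 0 < ε := ENNReal.ofReal_pos.mp (lt_of_le_of_lt zero_le hε)
  have hPc := h.continuous_of_mem hP
  have hC₀ : 0 < quadratureConst α C c L₀ κ₁ S := by
    rw [quadratureConst]
    positivity
  -- The summand 1 in `hsmall` is there for this bound; the other summand controls the error in the
  -- reproducing formula.
  have hcard : 2 * ε * (h.degrees (2 * L)).card ≤ 1 := by
    have h1 := h.card_le (2 * L) (by linarith)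
    have h2 : 0 ≤ C * L ^ α * ((1 + C ^ 2 * 2 ^ (S + 1) * κ₁) * L ^ α) := by positivity
    have h3 : 0 ≤ 2 * ε * (C * (2 * L) ^ α) := by positivity
    have h4 : 2 * ε * (h.degrees (2 * L)).card ≤ 2 * ε * (C * (2 * L) ^ α) := by gcongr
    nlinarith [mul_nonneg h3 h2]
  have hμr := (hμ.isRegularMeasure hL0).mono hL0 (le_add_of_nonneg_right hC₀.le)
  have hτr := (h.isRegularMeasure_of_quadrature hμ hκ₁ hL0 hτ hε hcard).mono hL0
    (le_add_of_nonneg_left hκ₁.le)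
  have hsum0 : 0 < κ₁ + quadratureConst α C c L₀ κ₁ S := by linarith
  have hK0 : 0 < K := by rw [hK]; positivity
  constructor
  · have h1 := h.eLpNorm_integral_kernel_le hL hsum0.le hμr hτr hPc hp
    rw [← hK] at h1
    -- The triangle inequality below needs measurability; the function is itself a finite
    -- combination of the φ_k.
    have hTc : Continuous fun x => ∫ y, P y * cutoffKernel φ ℓ L x y ∂τ := by
      have e : ∀ x, ∫ y, P y * cutoffKernel φ ℓ L x y ∂τ = ∑ k ∈ h.degrees (2 * L),
          (spectralCutoff (ℓ k / L) * ∫ y, P y * conj (φ k y) ∂τ) * φ k x := by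
        intro x
        simp only [h.cutoffKernel_eq_sum hL0, Finset.mul_sum]
        rw [integral_finsetSum]
        · refine Finset.sum_congr rfl fun k _ => ?_
          rw [mul_assoc, mul_comm (∫ y, P y * conj (φ k y) ∂τ), ← mul_assoc, ← integral_const_mul]
          congr 1
          funext y
          ring
        · intro k _
          have hk : Continuous fun y => P y * (spectralCutoff (ℓ k / L) * (φ k x * conj (φ k y))) :=
            hPc.mul (continuous_const.mul (continuous_const.mul
              (Complex.continuous_conj.comp (h.continuous k))))
          exact hk.integrable_of_compactSpace τ
      simp only [e]
      exact h.continuous_sum _ _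
    have hE : eLpNorm (fun x => P x - ∫ y, P y * cutoffKernel φ ℓ L x y ∂τ) p μ ≤
        eLpNorm P p μ / 2 := by
      have h2 : ∀ x, ‖P x - ∫ y, P y * cutoffKernel φ ℓ L x y ∂τ‖ ≤ (∫ y, ‖P y‖ ∂μ) / 2 := by
        intro x
        refine (h.norm_sub_integral_kernel_le hμ hκ₁ hL hτ hε hP x).trans ?_
        have h3 : 0 ≤ 2 * ε * (C * (2 * L) ^ α) := by positivity
        have h0 : 0 ≤ ∫ y, ‖P y‖ ∂μ := integral_nonneg fun y => norm_nonneg _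
        rw [div_eq_mul_one_div, mul_comm (∫ y, ‖P y‖ ∂μ)]
        refine mul_le_mul_of_nonneg_right ?_ h0
        linarith
      refine (eLpNorm_le_of_ae_bound (Eventually.of_forall h2)).trans ?_
      rw [measure_univ, ENNReal.one_rpow, one_mul, ENNReal.ofReal_div_of_pos two_pos,
        ENNReal.ofReal_ofNat, ofReal_integral_norm_eq_lintegral_enorm
          (hPc.integrable_of_compactSpace μ), ← eLpNorm_one_eq_lintegral_enorm]
      gcongr
      exact eLpNorm_le_eLpNorm_of_exponent_le (by exact_mod_cast hp) hPc.aestronglyMeasurable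
    have hfin : eLpNorm P p μ ≠ ⊤ :=
      (hPc.memLp_of_hasCompactSupport (HasCompactSupport.of_compactSpace P)).2.ne
    have h4 : eLpNorm P p μ ≤ ENNReal.ofReal K * eLpNorm P p τ + eLpNorm P p μ / 2 := by
      calc eLpNorm P p μ = eLpNorm ((fun x => ∫ y, P y * cutoffKernel φ ℓ L x y ∂τ) +
            fun x => P x - ∫ y, P y * cutoffKernel φ ℓ L x y ∂τ) p μ := by
            congr 1
            funext x
            simp
        _ ≤ _ := eLpNorm_add_le hTc.aestronglyMeasurable (hPc.sub hTc).aestronglyMeasurable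
            (by exact_mod_cast hp)
        _ ≤ _ := add_le_add h1 hE
    -- Absorbing half of the norm is legitimate because it is finite, P being continuous on a
    -- compact space.
    have h5 : eLpNorm P p μ / 2 ≤ ENNReal.ofReal K * eLpNorm P p τ := by
      exact (ENNReal.add_le_add_iff_right (ENNReal.div_ne_top hfin two_ne_zero)).mp
        ((ENNReal.add_halves _).le.trans h4)
    calc ENNReal.ofReal (1 / (2 * K)) * eLpNorm P p μ =
        ENNReal.ofReal (1 / K) * (eLpNorm P p μ / 2) := by
          rw [show 1 / (2 * K) = 1 / K * (1 / 2) by field_simp, ENNReal.ofReal_mul (by positivity),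
            mul_assoc, ENNReal.ofReal_div_of_pos two_pos, ENNReal.ofReal_one, ENNReal.ofReal_ofNat,
            ENNReal.div_eq_inv_mul, ENNReal.div_eq_inv_mul, mul_one]
      _ ≤ ENNReal.ofReal (1 / K) * (ENNReal.ofReal K * eLpNorm P p τ) := by gcongr
      _ = eLpNorm P p τ := by
          rw [← mul_assoc, ← ENNReal.ofReal_mul (by positivity), one_div_mul_cancel hK0.ne',
            ENNReal.ofReal_one, one_mul]
  -- Under μ the reproduction is exact, so the upper inequality has no error term.
  · have h1 := h.eLpNorm_integral_kernel_le hL hsum0.le hτr hμr hPc hp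
    rw [← hK] at h1
    simpa only [h.reproducing hL0 hP] using h1

end LocalizedSystem

theorem RapidlyDecreasing.eventually_lt {e : ℝ → ℝ≥0∞} (he : RapidlyDecreasing e) {s W : ℝ}
    (hs : 0 < s) (hW : 0 < W) :
    ∃ L₁ : ℝ, ∀ L : ℝ, L₁ ≤ L → 1 ≤ L → e (2 * L) < ENNReal.ofReal (1 / (W * L ^ s)) := by
  have h1 := (he s hs).eventually (gt_mem_nhds (ENNReal.ofReal_pos.mpr (one_div_pos.mpr hW)))
  obtain ⟨L₁, hL₁⟩ := h1.exists_forall_of_atTop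
  refine ⟨L₁, fun L hL hL1 => ?_⟩
  have h2 := hL₁ (2 * L) (by linarith)
  by_contra hcon
  refine absurd h2 (not_lt.mpr ?_)
  refine le_trans ?_ (mul_le_mul_right (not_lt.mp hcon) _)
  have hL0 : 0 < L := by linarith
  rw [← ENNReal.ofReal_mul (by positivity)]
  apply ENNReal.ofReal_le_ofReal
  have h3 : L ^ s ≤ (2 * L) ^ s := Real.rpow_le_rpow hL0.le (by linarith) hs.le
  rw [mul_one_div, div_le_div_iff₀ hW (by positivity)]
  nlinarith

theorem mainTheorem6 {q : ℕ} {M : Type*} [MetricSpace M] [CompactSpace M] [ConnectedSpace M]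
    [ChartedSpace (EuclideanSpace ℝ (Fin q)) M] [IsManifold (𝓡 q) ∞ M]
    [RiemannianBundle (fun x : M => TangentSpace (𝓡 q) x)]
    [IsContMDiffRiemannianBundle (𝓡 q) ∞ (EuclideanSpace ℝ (Fin q))
      (fun x : M => TangentSpace (𝓡 q) x)]
    [IsRiemannianManifold (𝓡 q) M]
    [MeasurableSpace M] [BorelSpace M] (μ : Measure M) [IsProbabilityMeasure μ]
    (α κ₁ κ₂ κ₃ κ₄ A : ℝ) (hα : 0 < α) (hκ₁ : 0 < κ₁) (hκ₂ : 0 < κ₂) (hκ₃ : 0 < κ₃)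
    (hκ₄ : 0 < κ₄) (hA : 2 ≤ A) (hμ : BallMeasureBound μ α κ₁) :
    ∃ c₁ c₂ : ℝ≥0 → ℝ≥0, (∀ p, 0 < c₁ p ∧ 0 < c₂ p) ∧
      ∀ e : ℝ → ℝ≥0∞, RapidlyDecreasing e →
        ∃ c : ℝ, 0 < c ∧
          ∀ (φ : ℕ → M → ℂ) (ℓ : ℕ → ℝ),
            IsDiffusionSystem μ φ ℓ →
            HeatKernelBounds (q := q) α κ₂ κ₃ κ₄ φ ℓ →
            BesselAssumption (q := q) μ φ →
            (∀ L : ℝ, 0 < L → productError μ φ ℓ A L ≤ e L) →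
            ∀ L : ℝ, c ≤ L →
            ∀ τ : Measure M, IsFiniteMeasure τ → IsQuadratureMeasure μ φ ℓ (2 * A * L) τ →
            ∀ p : ℝ≥0, 1 ≤ p → ∀ P ∈ diffusionPoly φ ℓ L,
              (c₁ p : ℝ≥0∞) * eLpNorm P p μ ≤ eLpNorm P p τ ∧
                eLpNorm P p τ ≤ (c₂ p : ℝ≥0∞) * eLpNorm P p μ := by
  obtain ⟨C, c, L₀, S, hC, hc, hL₀, hsys⟩ := exists_localizedSystem μ hα hκ₂ hκ₃ hκ₄
  set K : ℝ := C * 2 ^ (S + 1) * (κ₁ + LocalizedSystem.quadratureConst α C c L₀ κ₁ S) with hK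
  have hK0 : 0 < K := by
    rw [hK, LocalizedSystem.quadratureConst]
    positivity
  -- Schur's test gives the same constant for all p, so both functions are constant.
  refine ⟨fun _ => Real.toNNReal (1 / (2 * K)), fun _ => Real.toNNReal K,
    fun _ => ⟨Real.toNNReal_pos.mpr (by positivity), Real.toNNReal_pos.mpr hK0⟩, fun e he => ?_⟩
  set C₂ : ℝ := C ^ 2 * 2 ^ (S + 1) * κ₁ with hC₂
  have hC₂0 : 0 < C₂ := by positivity
  -- The smallness condition has left side at most 2 ε W L^(3α) for L ≥ 1, so ε = 1/(4 W L^(3α))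
  -- makes this bound exactly 1/2.
  set W : ℝ := C * 2 ^ α * (1 + C * (1 + C₂)) with hW
  have hW0 : 0 < W := by positivity
  obtain ⟨L₁, hL₁⟩ := he.eventually_lt (s := α + (α + α)) (W := 4 * W) (by positivity)
    (by positivity)
  refine ⟨max L₀ L₁, lt_max_of_lt_left (by linarith), fun φ ℓ hφ hheat _ hprod L hL τ _ hτ p hp P
    hP => ?_⟩
  have h := hsys φ ℓ hφ ⟨hheat.summable, hheat.upper, hheat.lower⟩
  have hLL₀ : L₀ ≤ L := (le_max_left _ _).trans hL
  have hL1 : 1 ≤ L := hL₀.trans hLL₀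
  have hL0 : 0 < L := by linarith
  have := hφ.isProbabilityMeasure_of_quadrature (by nlinarith) hτ
  have hε := (hprod (2 * L) (by linarith)).trans_lt (hL₁ L ((le_max_right _ _).trans hL) hL1)
  refine h.marcinkiewicz_zygmund hμ hκ₁ hLL₀ hτ hε ?_ hK hp hP
  have hLα : 1 ≤ L ^ α := Real.one_le_rpow hL1 hα.le
  rw [Real.mul_rpow two_pos.le hL0.le, Real.rpow_add hL0, Real.rpow_add hL0, ← hC₂]
  set X := L ^ α with hX
  have hX0 : 0 < X := by linarith
  calc 2 * (1 / (4 * W * (X * (X * X)))) * (C * (2 ^ α * X)) * (1 + C * X * ((1 + C₂) * X)) ≤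
      2 * (1 / (4 * W * (X * (X * X)))) * (C * (2 ^ α * X)) *
        (X * X + C * X * ((1 + C₂) * X)) := by
        gcongr
        nlinarith
    _ = 2 * (1 / (4 * W * (X * (X * X)))) * (W * (X * (X * X))) := by
        rw [hW]
        ring
    _ = 1 / 2 := by
        field_simp
        norm_num
    _ ≤ 1 / 2 := le_rfl
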